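/- Let $M$ be a smooth manifold, $E\to M$ a smooth vector bundle, $K\subseteq E$ a smooth subbundle and $F_M\subseteq TM$ an involutive subbundle. Let $\nabla^p\colon\Gamma(F_M)\times\Gamma(E/K)\to\Gamma(E/K)$ be a flat $F_M$-connection. Write $\bar e\in\Gamma(E/K)$ for the class of $e\in\Gamma(E)$ and $\bar X\in\Gamma(TM/F_M)$ for the class of $X\in\mathfrak X(M)$. **The Atiyah class.** An *extension* of $\nabla^p$ is a linear connection $\nabla\colon\mathfrak X(M)\times\Gamma(E)\to\Gamma(E)$ such that $\nabla_X k\in\Gamma(K)$ for all $X\in\mathfrak X(M)$, $k\in\Gamma(K)$, and $\overline{\nabla_Y e}=\nabla^p_Y\bar e$ for all $Y\in\Gamma(F_M)$, $e\in\Gamma(E)$. Its Atiyah form is the form $\omega_\nabla\in\Omega^1(F_M,\operatorname{Hom}(TM/F_M,\operatorname{End}(E/K)))$ given by $\omega_\nabla(Y)(\bar X)(\bar e)=\overline{R_\nabla(Y,X)e}$. It is closed for the differential $\mathbf d_{\nabla^p}$ of the flat $F_M$-connection $$(\nabla^{\operatorname{Hom}}_Y\phi)(\bar X)(\bar e)=\nabla^p_Y(\phi(\bar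 X)(\bar e))-\phi(\overline{[Y,X]})(\bar e)-\phi(\bar X)(\nabla^p_Y\bar e),$$ and the Atiyah class of $\nabla^p$ is $\alpha_{\nabla^p}=[\omega_\nabla]\in H^1_{\mathbf d_{\nabla^p}}(F_M,\operatorname{Hom}(TM/F_M,\operatorname{End}(E/K)))$, for any extension $\nabla$. **The quotient.** Let $(E/K)/\nabla^p$ be the quotient of $E/K$ by the equivalence relation generated by $\nabla^p$-parallel transport along smooth paths in the leaves of $F_M$. A *fibration of vector bundles* $\varphi\colon E\to E'$ over $\varphi_0\colon M\to M'$ is a smooth, fibrewise linear and fibrewise surjective map over a surjective submersion $\varphi_0$ with connected fibres. We say that $\nabla^p$ *induces a fibration of vector bundles* $E\to(E/K)/\nabla^p$ over $M\to M/F_M$ if there are a smooth manifold $M'=M/F_M$, a smooth vector bundle $E'=(E/K)/\nabla^p$ over $M'$ and a fibration of vector bundles $\varphi\colon E\to E'$ over $\varphi_0\colon M\to M'$ that are the quotient maps, that is: the fibres of $\varphi_0$ are the leaves of $F_M$ (so $F_M=\ker T\varphi_0$), and $\varphi(e)=\varphi(e')$ if and only if $\bar e$ and $\bar e'$ are equivalent.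 **Statement.** If $\nabla^p$ induces a fibration of vector bundles $E\to(E/K)/\nabla^p$ over $M\to M/F_M$, then $\alpha_{\nabla^p}=0$: extensions of $\nabla^p$ exist, and $[\omega_\nabla]=0$ for every extension $\nabla$. -/

import Mathlib

open scoped Manifold ContDiff

noncomputable section

open Bundle Set Filter Manifold
open scoped Topology

set_option linter.unusedSectionVars false
set_option linter.unusedVariables false

namespace VBAtiyah

variable {EM : Type*} [NormedAddCommGroup EM] [NormedSpace ℝ EM]
  {M : Type*} [TopologicalSpace M] [ChartedSpace EM M]
  {F : Type*} [NormedAddCommGroup F] [NormedSpace ℝ F]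
  {V : M → Type*} [∀ x, AddCommGroup (V x)] [∀ x, Module ℝ (V x)]
  [∀ x, TopologicalSpace (V x)] [TopologicalSpace (TotalSpace F V)] [FiberBundle F V]

/-! ### Smooth functions, sections and vector fields -/

/-- The ring `C^∞(M)` of smooth real functions. -/
abbrev Fn (EM : Type*) [NormedAddCommGroup EM] [NormedSpace ℝ EM]
    (M : Type*) [TopologicalSpace M] [ChartedSpace EM M] :=
  C^∞⟮𝓘(ℝ, EM), M; 𝓘(ℝ, ℝ), ℝ⟯

/-- The space `Γ(V)` of smooth sections of a vector bundle `V → M` with model fibre `F`. -/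
abbrev Sec (EM : Type*) [NormedAddCommGroup EM] [NormedSpace ℝ EM]
    {M : Type*} [TopologicalSpace M] [ChartedSpace EM M]
    (F : Type*) [NormedAddCommGroup F] [NormedSpace ℝ F]
    (V : M → Type*) [∀ x, TopologicalSpace (V x)]
    [TopologicalSpace (TotalSpace F V)] [FiberBundle F V] :=
  Cₛ^∞⟮𝓘(ℝ, EM); F, V⟯

/-- The space `𝔛(M)` of smooth vector fields. -/
abbrev VF (EM : Type*) [NormedAddCommGroup EM] [NormedSpace ℝ EM]
    (M : Type*) [TopologicalSpace M] [ChartedSpace EM M] [IsManifold 𝓘(ℝ, EM) ∞ M] :=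
  Sec EM EM (TangentSpace 𝓘(ℝ, EM) : M → Type _)

section ModuleStructure

variable [VectorBundle ℝ F V]

instance secSMul : SMul (Fn EM M) (Sec EM F V) :=
  ⟨fun f s ↦ ⟨fun x ↦ f x • s x, f.contMDiff.smul_section s.contMDiff⟩⟩

@[simp] theorem sec_smul_apply (f : Fn EM M) (s : Sec EM F V) (x : M) :
    (f • s) x = f x • s x := rfl

@[simp] theorem sec_add_apply (s t : Sec EM F V) (x : M) : (s + t) x = s x + t x := rfl

@[simp] theorem sec_neg_apply (s : Sec EM F V) (x : M) : (-s) x = -s x := rfl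

@[simp] theorem sec_sub_apply (s t : Sec EM F V) (x : M) : (s - t) x = s x - t x := rfl

@[simp] theorem sec_zero_apply (x : M) : (0 : Sec EM F V) x = 0 := rfl

@[simp] theorem sec_real_smul_apply (r : ℝ) (s : Sec EM F V) (x : M) :
    (r • s) x = r • s x := rfl

instance secModule : Module (Fn EM M) (Sec EM F V) where
  one_smul s := by ext x; simp
  mul_smul f g s := by ext x; simp [mul_smul]
  smul_zero f := by ext x; simp
  smul_add f s t := by ext x; simp
  add_smul f g s := by ext x; simp [add_smul]
  zero_smul s := by ext x; simp

instance secTower : IsScalarTower ℝ (Fn EM M) (Sec EM F V) :=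
  ⟨fun r f s ↦ by ext x; simp [mul_smul]⟩

end ModuleStructure

/-! ### Subbundles and sections of quotient bundles -/

/-- A smooth subbundle of `V`: a family of subspaces of the fibres that is locally spanned by
a smooth frame. -/
structure Subbundle (EM : Type*) [NormedAddCommGroup EM] [NormedSpace ℝ EM]
    {M : Type*} [TopologicalSpace M] [ChartedSpace EM M]
    (F : Type*) [NormedAddCommGroup F] [NormedSpace ℝ F]
    (V : M → Type*) [∀ x, AddCommGroup (V x)] [∀ x, Module ℝ (V x)]
    [∀ x, TopologicalSpace (V x)] [TopologicalSpace (TotalSpace F V)] [FiberBundle F V] where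
  /-- The fibre over a point. -/
  fiber : ∀ x : M, Submodule ℝ (V x)
  locally_framed : ∀ x : M, ∃ U : Set M, IsOpen U ∧ x ∈ U ∧
    ∃ (k : ℕ) (b : Fin k → ∀ y, V y),
      (∀ i, ContMDiffOn 𝓘(ℝ, EM) (𝓘(ℝ, EM).prod 𝓘(ℝ, F)) ∞
        (fun y ↦ (⟨y, b i y⟩ : TotalSpace F V)) U) ∧
      ∀ y ∈ U, LinearIndependent ℝ (fun i ↦ b i y) ∧
        Submodule.span ℝ (range fun i ↦ b i y) = fiber y

namespace Subbundle

variable (K : Subbundle EM F V)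

/-- A section of the quotient bundle `V/K` is smooth if it lifts, locally, to smooth sections
of `V`. -/
def IsSmoothQuot (s : ∀ x : M, V x ⧸ K.fiber x) : Prop :=
  ∀ x : M, ∃ U : Set M, IsOpen U ∧ x ∈ U ∧ ∃ e : ∀ y, V y,
    ContMDiffOn 𝓘(ℝ, EM) (𝓘(ℝ, EM).prod 𝓘(ℝ, F)) ∞
      (fun y ↦ (⟨y, e y⟩ : TotalSpace F V)) U ∧
    ∀ y ∈ U, s y = (K.fiber y).mkQ (e y)

variable [VectorBundle ℝ F V]

/-- The space `Γ(K)`, as a `C^∞(M)`-submodule of `Γ(V)`. -/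
def sections : Submodule (Fn EM M) (Sec EM F V) where
  carrier := {s | ∀ x, s x ∈ K.fiber x}
  add_mem' hs ht x := (K.fiber x).add_mem (hs x) (ht x)
  zero_mem' x := (K.fiber x).zero_mem
  smul_mem' f _ hs x := (K.fiber x).smul_mem (f x) (hs x)

theorem mem_sections {s : Sec EM F V} : s ∈ K.sections ↔ ∀ x, s x ∈ K.fiber x := Iff.rfl

/-- The space `Γ(K)`, as a type. -/
def SSec : Type _ := K.sections

instance : AddCommGroup K.SSec := inferInstanceAs (AddCommGroup K.sections)

instance : Module (Fn EM M) K.SSec := inferInstanceAs (Module (Fn EM M) K.sections)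

instance : Module ℝ K.SSec := inferInstanceAs (Module ℝ K.sections)

instance : IsScalarTower ℝ (Fn EM M) K.SSec :=
  inferInstanceAs (IsScalarTower ℝ (Fn EM M) K.sections)

theorem ssec_add_val (s t : K.SSec) : (s + t).1 = s.1 + t.1 := rfl

theorem ssec_smul_val (f : Fn EM M) (s : K.SSec) : (f • s).1 = f • s.1 := rfl

/-- The space `Γ(V/K)` of smooth sections of the quotient bundle. -/
def quotSections : Submodule ℝ (∀ x : M, V x ⧸ K.fiber x) where
  carrier := {s | K.IsSmoothQuot s}
  add_mem' {s t} hs ht x := by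
    obtain ⟨U, hU, hxU, e, he, hse⟩ := hs x
    obtain ⟨W, hW, hxW, e', he', hte⟩ := ht x
    refine ⟨U ∩ W, hU.inter hW, ⟨hxU, hxW⟩, e + e', ?_, fun y hy ↦ ?_⟩
    · exact (he.mono inter_subset_left).add_section (he'.mono inter_subset_right)
    · simp [hse y hy.1, hte y hy.2]
  zero_mem' x := ⟨univ, isOpen_univ, mem_univ _, fun _ ↦ 0,
    (0 : Sec EM F V).contMDiff.contMDiffOn, fun y _ ↦ by simp⟩
  smul_mem' r s hs x := by
    obtain ⟨U, hU, hxU, e, he, hse⟩ := hs x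
    exact ⟨U, hU, hxU, r • e, he.const_smul_section, fun y hy ↦ by simp [hse y hy]⟩

/-- The space `Γ(V/K)` of smooth sections of the quotient bundle, as a type. -/
def QSec : Type _ := K.quotSections

instance : AddCommGroup K.QSec := inferInstanceAs (AddCommGroup K.quotSections)

instance : Module ℝ K.QSec := inferInstanceAs (Module ℝ K.quotSections)

instance : CoeFun K.QSec (fun _ ↦ ∀ y, V y ⧸ K.fiber y) := ⟨Subtype.val⟩

variable {K} in
theorem QSec.ext {s t : K.QSec} (h : ∀ x, s x = t x) : s = t := Subtype.ext (funext h)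

@[simp] theorem quot_add_apply (s t : K.QSec) (x : M) : (s + t) x = s x + t x := rfl

@[simp] theorem quot_zero_apply (x : M) : (0 : K.QSec) x = 0 := rfl

@[simp] theorem quot_real_smul_apply (r : ℝ) (s : K.QSec) (x : M) : (r • s) x = r • s x := rfl

instance quotSMul : SMul (Fn EM M) K.QSec :=
  ⟨fun f s ↦ ⟨fun x ↦ f x • s x, fun x ↦ by
    obtain ⟨U, hU, hxU, e, he, hse⟩ := s.2 x
    exact ⟨U, hU, hxU, fun y ↦ f y • e y, f.contMDiff.contMDiffOn.smul_section he,
      fun y hy ↦ by simp [hse y hy]⟩⟩⟩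

@[simp] theorem quot_smul_apply (f : Fn EM M) (s : K.QSec) (x : M) : (f • s) x = f x • s x := rfl

instance quotModule : Module (Fn EM M) K.QSec where
  one_smul s := by apply QSec.ext; simp
  mul_smul f g s := by apply QSec.ext; simp [mul_smul]
  smul_zero f := by apply QSec.ext; simp
  smul_add f s t := by apply QSec.ext; simp
  add_smul f g s := by apply QSec.ext; simp [add_smul]
  zero_smul s := by apply QSec.ext; simp

instance quotTower : IsScalarTower ℝ (Fn EM M) K.QSec :=
  ⟨fun r f s ↦ by apply QSec.ext; simp [mul_smul]⟩

/-- The projection `Γ(V) → Γ(V/K)`, `e ↦ ē`. -/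
def proj : Sec EM F V →ₗ[Fn EM M] K.QSec where
  toFun e := ⟨fun x ↦ (K.fiber x).mkQ (e x), fun x ↦
    ⟨univ, isOpen_univ, mem_univ _, e, e.contMDiff.contMDiffOn, fun _ _ ↦ rfl⟩⟩
  map_add' _ _ := rfl
  map_smul' _ _ := rfl

@[simp] theorem proj_apply (e : Sec EM F V) (x : M) : K.proj e x = (K.fiber x).mkQ (e x) := rfl

theorem proj_eq_zero {e : Sec EM F V} : K.proj e = 0 ↔ e ∈ K.sections := by
  rw [mem_sections]
  refine ⟨fun h x ↦ ?_, fun h ↦ QSec.ext fun x ↦ ?_⟩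
  · have := congrArg (fun s : K.QSec ↦ s x) h
    simpa using this
  · simpa using h x

theorem proj_surjective [FiniteDimensional ℝ EM] [IsManifold 𝓘(ℝ, EM) ∞ M] [T2Space M]
    [SigmaCompactSpace M] : Function.Surjective K.proj := by
  intro s
  obtain ⟨e, he⟩ := exists_contMDiffSection_forall_mem_convex_of_local (n := ⊤) 𝓘(ℝ, EM)
    (F_fiber := F) V (fun x ↦ {v | (K.fiber x).mkQ v = s x})
    (fun x ↦ by
      intro v hv w hw a b _ _ hab
      simp only [mem_ofPred_eq] at hv hw ⊢
      rw [map_add, map_smul, map_smul, hv, hw, ← add_smul, hab, one_smul])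
    (fun x ↦ by
      obtain ⟨U, hU, hxU, e, he, hse⟩ := s.2 x
      exact ⟨U, hU.mem_nhds hxU, e, he, fun y hy ↦ (hse y hy).symm⟩)
  exact ⟨e, QSec.ext he⟩

variable [FiniteDimensional ℝ EM] [IsManifold 𝓘(ℝ, EM) ∞ M] [T2Space M] [SigmaCompactSpace M]

/-- A `C^∞(M)`-linear map on `Γ(V)` that vanishes on `Γ(K)`, as a map on `Γ(V/K)`. -/
def desc {N : Type*} [AddCommGroup N] [Module (Fn EM M) N] (f : Sec EM F V →ₗ[Fn EM M] N)
    (hf : ∀ e ∈ K.sections, f e = 0) : K.QSec →ₗ[Fn EM M] N :=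
  (LinearMap.ker K.proj).liftQ f (fun e he ↦ hf e (K.proj_eq_zero.1 he)) ∘ₗ
    (K.proj.quotKerEquivOfSurjective K.proj_surjective).symm.toLinearMap

@[simp] theorem desc_proj {N : Type*} [AddCommGroup N] [Module (Fn EM M) N]
    (f : Sec EM F V →ₗ[Fn EM M] N) (hf : ∀ e ∈ K.sections, f e = 0) (e : Sec EM F V) :
    K.desc f hf (K.proj e) = f e := by
  have : (K.proj.quotKerEquivOfSurjective K.proj_surjective).symm (K.proj e)
      = Submodule.Quotient.mk e := by
    rw [LinearEquiv.symm_apply_eq]; rfl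
  simp only [desc, LinearMap.coe_comp, LinearEquiv.coe_coe, Function.comp_apply, this]
  exact Submodule.liftQ_apply ..

end Subbundle

/-! ### The Lie derivative of functions and the Lie bracket -/

section VectorFields

variable [IsManifold 𝓘(ℝ, EM) ∞ M]

/-- The derivative `X f` of a function along a vector field. -/
def lieD (X : VF EM M) (f : Fn EM M) : Fn EM M :=
  ⟨fun x ↦ mvfderiv 𝓘(ℝ, EM) f x (X x), by
    have h := (f.contMDiff.contMDiff_tangentMap (m := ∞) (by simp)).comp X.contMDiff
    exact (contMDiff_snd_tangentBundle_modelSpace ℝ 𝓘(ℝ, ℝ)).comp h⟩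

theorem lieD_apply (X : VF EM M) (f : Fn EM M) (x : M) :
    lieD X f x = mvfderiv 𝓘(ℝ, EM) f x (X x) := rfl

theorem lieD_add_left (X Y : VF EM M) (f : Fn EM M) : lieD (X + Y) f = lieD X f + lieD Y f := by
  ext x; simp [lieD_apply]

theorem lieD_smul_left (g : Fn EM M) (X : VF EM M) (f : Fn EM M) :
    lieD (g • X) f = g * lieD X f := by
  ext x; simp [lieD_apply]

variable [FiniteDimensional ℝ EM]

/-- The Lie bracket `[X, Y]` of vector fields. -/
def bracket (X Y : VF EM M) : VF EM M :=
  ⟨VectorField.mlieBracket 𝓘(ℝ, EM) X Y, by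
    have : IsManifold 𝓘(ℝ, EM) (((⊤ : ℕ∞) : ℕ∞ω) + 1) M := by simpa
    have : CompleteSpace EM := FiniteDimensional.complete ℝ EM
    have : IsManifold 𝓘(ℝ, EM) (minSmoothness ℝ 2) M := by
      rw [minSmoothness_of_isRCLikeNormedField]
      exact IsManifold.of_le (n := ∞) (WithTop.coe_le_coe.2 le_top)
    exact ContDiff.mlieBracket_vectorField (m := ⊤) (n := ⊤) X.contMDiff Y.contMDiff (by simp)⟩

theorem bracket_swap (X Y : VF EM M) : bracket X Y = -bracket Y X := by
  ext x; exact VectorField.mlieBracket_swap_apply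

theorem bracket_add_left (X Y Z : VF EM M) :
    bracket (X + Y) Z = bracket X Z + bracket Y Z := by
  have : CompleteSpace EM := FiniteDimensional.complete ℝ EM
  ext x
  exact VectorField.mlieBracket_add_left X.mdifferentiableAt Y.mdifferentiableAt

theorem bracket_add_right (X Y Z : VF EM M) :
    bracket X (Y + Z) = bracket X Y + bracket X Z := by
  rw [bracket_swap, bracket_add_left, bracket_swap Y, bracket_swap Z]; abel

theorem bracket_smul_right (f : Fn EM M) (X Y : VF EM M) :
    bracket X (f • Y) = f • bracket X Y + lieD X f • Y := by
  have : CompleteSpace EM := FiniteDimensional.complete ℝ EM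
  ext x
  rw [add_comm]
  exact VectorField.mlieBracket_smul_right (f.contMDiff.mdifferentiable (by simp) x)
    Y.mdifferentiableAt

theorem bracket_smul_left (f : Fn EM M) (X Y : VF EM M) :
    bracket (f • X) Y = f • bracket X Y - lieD Y f • X := by
  rw [bracket_swap, bracket_smul_right, bracket_swap Y X]; module

theorem bracket_leibniz (X Y Z : VF EM M) :
    bracket X (bracket Y Z) = bracket (bracket X Y) Z + bracket Y (bracket X Z) := by
  have : CompleteSpace EM := FiniteDimensional.complete ℝ EM
  have h3 : minSmoothness ℝ 3 = 3 := by simp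
  have h2 : minSmoothness ℝ 2 ≤ ∞ := by
    rw [minSmoothness_of_isRCLikeNormedField]; exact WithTop.coe_le_coe.2 le_top
  have : IsManifold 𝓘(ℝ, EM) (minSmoothness ℝ 3) M := by
    rw [h3]; exact IsManifold.of_le (n := ∞) (WithTop.coe_le_coe.2 le_top)
  ext x
  exact VectorField.leibniz_identity_mlieBracket_apply ((X.contMDiff x).of_le h2)
    ((Y.contMDiff x).of_le h2) ((Z.contMDiff x).of_le h2)

theorem exists_vf_apply_eq [T2Space M] [SigmaCompactSpace M] (x : M)
    (v : TangentSpace 𝓘(ℝ, EM) x) : ∃ X : VF EM M, X x = v := by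
  obtain ⟨X, hX⟩ := exists_contMDiffSection_forall_mem_convex_of_local (n := ⊤) 𝓘(ℝ, EM)
    (F_fiber := EM) (TangentSpace 𝓘(ℝ, EM) : M → Type _)
    (fun y ↦ {w | ∀ h : x = y, w = h ▸ v})
    (fun y ↦ by
      intro w hw w' hw' a b _ _ hab h
      rw [hw h, hw' h, ← add_smul, hab, one_smul])
    (fun y ↦ by
      by_cases hy : x = y
      · subst hy
        obtain ⟨U, hU, hs⟩ := FiberBundle.exists_contMDiffOn_extend (I := 𝓘(ℝ, EM)) (k := ∞) (F := EM) v
        refine ⟨U, hU, _, hs, fun z _ h ↦ ?_⟩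
        subst h
        exact FiberBundle.extend_apply_self ..
      · exact ⟨{x}ᶜ, isOpen_compl_singleton.mem_nhds (Ne.symm hy), fun _ ↦ 0,
          (0 : VF EM M).contMDiff.contMDiffOn, fun z hz h ↦ absurd h.symm hz⟩)
  exact ⟨X, hX x rfl⟩

/-- The bracket of vector fields is the commutator of derivations. -/
theorem lieD_bracket [T2Space M] [SigmaCompactSpace M] (X Y : VF EM M) (f : Fn EM M) :
    lieD (bracket X Y) f = lieD X (lieD Y f) - lieD Y (lieD X f) := by
  have key : ∀ Z : VF EM M,
      (lieD (bracket X Y) f - (lieD X (lieD Y f) - lieD Y (lieD X f))) • Z = 0 := by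
    intro Z
    have h := bracket_leibniz X Y (f • Z)
    simp only [bracket_smul_right, bracket_add_right] at h
    rw [bracket_leibniz X Y Z] at h
    simp only [sub_smul]
    rw [← sub_eq_zero] at h
    rw [← neg_eq_zero, ← h]
    module
  ext x
  by_cases hx : ∃ v : TangentSpace 𝓘(ℝ, EM) x, v ≠ 0
  · obtain ⟨v, hv⟩ := hx
    obtain ⟨Z, hZ⟩ := exists_vf_apply_eq x v
    have h := congrArg (fun W : VF EM M ↦ W x) (key Z)
    simp only [sec_smul_apply, sec_zero_apply, hZ] at h
    have := (smul_eq_zero.1 h).resolve_right hv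
    exact sub_eq_zero.1 this
  · push Not at hx
    simp [lieD_apply, hx (bracket X Y x), hx (X x), hx (Y x)]

end VectorFields

/-! ### Partial connections and the Bott connection -/

/-- An involutive subbundle of the tangent bundle. -/
structure InvolutiveSubbundle (EM : Type*) [NormedAddCommGroup EM] [NormedSpace ℝ EM]
    [FiniteDimensional ℝ EM] (M : Type*) [TopologicalSpace M] [ChartedSpace EM M]
    [IsManifold 𝓘(ℝ, EM) ∞ M] extends
    Subbundle EM EM (TangentSpace 𝓘(ℝ, EM) : M → Type _) where
  involutive : ∀ X ∈ toSubbundle.sections, ∀ Y ∈ toSubbundle.sections,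
    bracket X Y ∈ toSubbundle.sections

variable [FiniteDimensional ℝ EM] [IsManifold 𝓘(ℝ, EM) ∞ M] [VectorBundle ℝ F V]

/-- The Lie bracket of `Γ(D)`. -/
def InvolutiveSubbundle.br (D : InvolutiveSubbundle EM M) (Y Z : D.SSec) : D.SSec :=
  ⟨bracket Y.1 Z.1, D.involutive _ Y.2 _ Z.2⟩

/-- A `D`-connection `Γ(D) × Γ(V/K) → Γ(V/K)`. -/
structure PartialConnection (D : InvolutiveSubbundle EM M) (K : Subbundle EM F V) where
  /-- The operator `(Y, s) ↦ ∇_Y s`. -/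
  op : D.SSec → K.QSec → K.QSec
  add_left : ∀ Y Z s, op (Y + Z) s = op Y s + op Z s
  smul_left : ∀ (f : Fn EM M) Y s, op (f • Y) s = f • op Y s
  add_right : ∀ Y s t, op Y (s + t) = op Y s + op Y t
  leibniz : ∀ Y (f : Fn EM M) s, op Y (f • s) = f • op Y s + lieD Y.1 f • s

/-- A linear connection `𝔛(M) × Γ(V) → Γ(V)`. -/
structure LinearConnection (EM : Type*) [NormedAddCommGroup EM] [NormedSpace ℝ EM]
    {M : Type*} [TopologicalSpace M] [ChartedSpace EM M] [IsManifold 𝓘(ℝ, EM) ∞ M]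
    (F : Type*) [NormedAddCommGroup F] [NormedSpace ℝ F]
    (V : M → Type*) [∀ x, AddCommGroup (V x)] [∀ x, Module ℝ (V x)]
    [∀ x, TopologicalSpace (V x)] [TopologicalSpace (TotalSpace F V)] [FiberBundle F V]
    [VectorBundle ℝ F V] where
  /-- The operator `(X, e) ↦ ∇_X e`. -/
  op : VF EM M → Sec EM F V → Sec EM F V
  add_left : ∀ X Y e, op (X + Y) e = op X e + op Y e
  smul_left : ∀ (f : Fn EM M) X e, op (f • X) e = f • op X e
  add_right : ∀ X e e', op X (e + e') = op X e + op X e'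
  leibniz : ∀ X (f : Fn EM M) e, op X (f • e) = f • op X e + lieD X f • e

namespace PartialConnection

variable {D : InvolutiveSubbundle EM M} {K : Subbundle EM F V} (P : PartialConnection D K)

/-- Flatness: the curvature of the partial connection vanishes. -/
def IsFlat : Prop :=
  ∀ Y Z s, P.op Y (P.op Z s) - P.op Z (P.op Y s) - P.op (D.br Y Z) s = 0

theorem op_zero (Y : D.SSec) : P.op Y 0 = 0 := by
  have := P.add_right Y 0 0
  simpa using this

theorem op_neg (Y : D.SSec) (s : K.QSec) : P.op Y (-s) = -P.op Y s := by
  have := P.add_right Y s (-s)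
  rw [add_neg_cancel, op_zero] at this
  exact (neg_eq_of_add_eq_zero_right this.symm).symm

theorem op_sub (Y : D.SSec) (s t : K.QSec) :
    P.op Y (s - t) = P.op Y s - P.op Y t := by
  rw [sub_eq_add_neg, P.add_right, op_neg, ← sub_eq_add_neg]

theorem neg_op (Y : D.SSec) (s : K.QSec) : P.op (-Y) s = -P.op Y s := by
  have h0 : P.op 0 s = 0 := by simpa using P.add_left 0 0 s
  have h := P.add_left Y (-Y) s
  rw [add_neg_cancel, h0] at h
  exact (neg_eq_of_add_eq_zero_right h.symm).symm

end PartialConnection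

namespace LinearConnection

variable (N : LinearConnection EM F V)

theorem op_zero (X : VF EM M) : N.op X 0 = 0 := by
  have := N.add_right X 0 0
  simpa using this

theorem op_neg (X : VF EM M) (e : Sec EM F V) : N.op X (-e) = -N.op X e := by
  have := N.add_right X e (-e)
  rw [add_neg_cancel, op_zero] at this
  exact (neg_eq_of_add_eq_zero_right this.symm).symm

theorem op_sub (X : VF EM M) (e e' : Sec EM F V) : N.op X (e - e') = N.op X e - N.op X e' := by
  rw [sub_eq_add_neg, N.add_right, op_neg, ← sub_eq_add_neg]

theorem neg_op (X : VF EM M) (e : Sec EM F V) : N.op (-X) e = -N.op X e := by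
  have h0 : N.op 0 e = 0 := by simpa using N.add_left 0 0 e
  have h := N.add_left X (-X) e
  rw [add_neg_cancel, h0] at h
  exact (neg_eq_of_add_eq_zero_right h.symm).symm

theorem sub_op (X Y : VF EM M) (e : Sec EM F V) : N.op (X - Y) e = N.op X e - N.op Y e := by
  rw [sub_eq_add_neg, N.add_left, neg_op, ← sub_eq_add_neg]

/-- The curvature `R(X, Y) e = ∇_X ∇_Y e - ∇_Y ∇_X e - ∇_[X, Y] e`. -/
def curv (X Y : VF EM M) (e : Sec EM F V) : Sec EM F V :=
  N.op X (N.op Y e) - N.op Y (N.op X e) - N.op (bracket X Y) e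

variable [T2Space M] [SigmaCompactSpace M]

theorem curv_add_right (X Y : VF EM M) (e e' : Sec EM F V) :
    N.curv X Y (e + e') = N.curv X Y e + N.curv X Y e' := by
  simp only [curv, N.add_right]; abel

theorem curv_smul_right (f : Fn EM M) (X Y : VF EM M) (e : Sec EM F V) :
    N.curv X Y (f • e) = f • N.curv X Y e := by
  simp only [curv, N.add_right, N.leibniz, lieD_bracket]; module

theorem curv_swap (X Y : VF EM M) (e : Sec EM F V) : N.curv X Y e = -N.curv Y X e := by
  simp only [curv, bracket_swap X Y, N.neg_op]; abel

theorem curv_add_left (X X' Y : VF EM M) (e : Sec EM F V) :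
    N.curv (X + X') Y e = N.curv X Y e + N.curv X' Y e := by
  simp only [curv, N.add_right, N.add_left, bracket_add_left]; abel

theorem curv_smul_left (f : Fn EM M) (X Y : VF EM M) (e : Sec EM F V) :
    N.curv (f • X) Y e = f • N.curv X Y e := by
  simp only [curv, N.smul_left, N.leibniz, bracket_smul_left, N.sub_op]; module

end LinearConnection

variable [T2Space M] [SigmaCompactSpace M]

/-- A lift of a section of `V/K` to a section of `V`. -/
def Subbundle.lift (K : Subbundle EM F V) (s : K.QSec) : Sec EM F V :=
  (K.proj_surjective s).choose

@[simp] theorem Subbundle.proj_lift (K : Subbundle EM F V) (s : K.QSec) :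
    K.proj (K.lift s) = s := (K.proj_surjective s).choose_spec

namespace InvolutiveSubbundle

variable (D : InvolutiveSubbundle EM M)

/-- The operator `(Y, X̄) ↦ [Y, X]‾` of the Bott connection. -/
def bottOp (Y : D.SSec) (s : D.QSec) : D.QSec :=
  D.proj (bracket Y.1 (D.lift s))

theorem bottOp_proj (Y : D.SSec) (X : VF EM M) :
    D.bottOp Y (D.proj X) = D.proj (bracket Y.1 X) := by
  have h : D.lift (D.proj X) - X ∈ D.sections := by
    rw [← D.proj_eq_zero, map_sub, D.proj_lift, sub_self]
  have h' := (D.proj_eq_zero).2 (D.involutive _ Y.2 _ h)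
  have e : bracket Y.1 (D.lift (D.proj X)) =
      bracket Y.1 (D.lift (D.proj X) - X) + bracket Y.1 X := by
    rw [← bracket_add_right, sub_add_cancel]
  rw [bottOp, e, map_add, h', zero_add]

/-- The Bott connection `Γ(D) × Γ(TM/D) → Γ(TM/D)`, `∇_Y X̄ = [Y, X]‾`. -/
def bott : PartialConnection D D.toSubbundle where
  op := D.bottOp
  add_left Y Z s := by
    obtain ⟨X, rfl⟩ := D.proj_surjective s
    simp only [bottOp_proj, Subbundle.ssec_add_val, bracket_add_left, map_add]
  smul_left f Y s := by
    obtain ⟨X, rfl⟩ := D.proj_surjective s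
    have : D.proj Y.1 = 0 := D.proj_eq_zero.2 Y.2
    simp only [bottOp_proj, Subbundle.ssec_smul_val, bracket_smul_left, map_sub, map_smul, this,
      smul_zero, sub_zero]
  add_right Y s t := by
    obtain ⟨X, rfl⟩ := D.proj_surjective s
    obtain ⟨X', rfl⟩ := D.proj_surjective t
    simp only [← map_add, bottOp_proj, bracket_add_right]
  leibniz Y f s := by
    obtain ⟨X, rfl⟩ := D.proj_surjective s
    simp only [← map_smul, ← map_add, bottOp_proj, bracket_smul_right]

@[simp] theorem bott_op_proj (Y : D.SSec) (X : VF EM M) :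
    D.bott.op Y (D.proj X) = D.proj (bracket Y.1 X) := D.bottOp_proj Y X

end InvolutiveSubbundle

/-! ### The complex `Ω^•(D, Hom(TM/D, End(V/K)))` in degrees `0`, `1`, `2` -/

/-- `Ω⁰(D, Hom(TM/D, End(V/K)))`: sections of `Hom(TM/D, End(V/K))`, as `C^∞(M)`-linear maps. -/
abbrev Omega0 (D : InvolutiveSubbundle EM M) (K : Subbundle EM F V) :=
  D.QSec →ₗ[Fn EM M] K.QSec →ₗ[Fn EM M] K.QSec

/-- `Ω¹(D, Hom(TM/D, End(V/K)))`. -/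
abbrev Omega1 (D : InvolutiveSubbundle EM M) (K : Subbundle EM F V) :=
  D.SSec →ₗ[Fn EM M] Omega0 D K

/-- Bilinear forms on `D` with values in `Hom(TM/D, End(V/K))`; they contain
`Ω²(D, Hom(TM/D, End(V/K)))`. -/
abbrev Omega2 (D : InvolutiveSubbundle EM M) (K : Subbundle EM F V) :=
  D.SSec →ₗ[Fn EM M] D.SSec →ₗ[Fn EM M] Omega0 D K

namespace PartialConnection

variable {D : InvolutiveSubbundle EM M} {K : Subbundle EM F V} (P : PartialConnection D K)

/-- The induced connection on `Hom(TM/D, End(V/K))`: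
`(∇_Y φ)(X̄)(ē) = ∇_Y (φ(X̄)(ē)) - φ(∇_Y X̄)(ē) - φ(X̄)(∇_Y ē)`. -/
def homOp (Y : D.SSec) (φ : Omega0 D K) : Omega0 D K :=
  LinearMap.mk₂ (Fn EM M)
    (fun X e ↦ P.op Y (φ X e) - φ (D.bott.op Y X) e - φ X (P.op Y e))
    (fun X X' e ↦ by
      simp only [map_add, LinearMap.add_apply, P.add_right, D.bott.add_right]; abel)
    (fun f X e ↦ by
      simp only [map_smul, map_add, LinearMap.smul_apply, LinearMap.add_apply, P.leibniz,
        D.bott.leibniz]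
      module)
    (fun X e e' ↦ by simp only [map_add, P.add_right]; abel)
    (fun f X e ↦ by simp only [map_smul, map_add, P.leibniz]; module)

@[simp] theorem homOp_apply (Y : D.SSec) (φ : Omega0 D K) (X : D.QSec)
    (e : K.QSec) :
    P.homOp Y φ X e = P.op Y (φ X e) - φ (D.bott.op Y X) e - φ X (P.op Y e) := rfl

theorem op_real_smul (Y : D.SSec) (r : ℝ) (s : K.QSec) :
    P.op Y (r • s) = r • P.op Y s := by
  have h := P.leibniz Y (algebraMap ℝ (Fn EM M) r) s
  rw [algebraMap_smul, algebraMap_smul] at h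
  have h0 : lieD Y.1 (algebraMap ℝ (Fn EM M) r) = 0 := by
    ext x
    have : lieD Y.1 (algebraMap ℝ (Fn EM M) r) x =
      mvfderiv 𝓘(ℝ, EM) (fun _ : M ↦ r) x (Y.1 x) := rfl
    rw [this]
    simp [mvfderiv, mfderiv_const]
  rw [h, h0, zero_smul, add_zero]

/-- The differential `Ω⁰ → Ω¹`, `φ ↦ (Y ↦ ∇_Y φ)`. -/
def d0 : Omega0 D K →ₗ[ℝ] Omega1 D K where
  toFun φ :=
    { toFun := fun Y ↦ P.homOp Y φ
      map_add' := fun Y Z ↦ by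
        ext X e : 2
        simp only [homOp_apply, P.add_left, D.bott.add_left, map_add, LinearMap.add_apply]; abel
      map_smul' := fun f Y ↦ by
        ext X e : 2
        simp only [homOp_apply, P.smul_left, D.bott.smul_left, map_smul, LinearMap.smul_apply,
          RingHom.id_apply]
        module }
  map_add' φ ψ := by
    ext Y X e : 3
    simp only [LinearMap.coe_mk, AddHom.coe_mk, homOp_apply, LinearMap.add_apply, P.add_right]
    abel
  map_smul' r φ := by
    ext Y X e : 3
    simp only [LinearMap.coe_mk, AddHom.coe_mk, homOp_apply, LinearMap.smul_apply,
      P.op_real_smul, RingHom.id_apply]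
    module

@[simp] theorem d0_apply (φ : Omega0 D K) (Y : D.SSec) : P.d0 φ Y = P.homOp Y φ := rfl

theorem br_swap (D : InvolutiveSubbundle EM M) (Y Z : D.SSec) : D.br Y Z = -D.br Z Y :=
  Subtype.ext (bracket_swap Y.1 Z.1)

theorem br_add_right (D : InvolutiveSubbundle EM M) (Y Z W : D.SSec) :
    D.br Y (Z + W) = D.br Y Z + D.br Y W :=
  Subtype.ext (bracket_add_right Y.1 Z.1 W.1)

theorem br_smul_right (D : InvolutiveSubbundle EM M) (f : Fn EM M) (Y Z : D.SSec) :
    D.br Y (f • Z) = f • D.br Y Z + lieD Y.1 f • Z :=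
  Subtype.ext (bracket_smul_right f Y.1 Z.1)

theorem homOp_add (Y : D.SSec) (φ ψ : Omega0 D K) :
    P.homOp Y (φ + ψ) = P.homOp Y φ + P.homOp Y ψ := by
  ext X e : 2
  simp only [homOp_apply, LinearMap.add_apply, P.add_right]; abel

theorem homOp_smul (Y : D.SSec) (f : Fn EM M) (φ : Omega0 D K) :
    P.homOp Y (f • φ) = f • P.homOp Y φ + lieD Y.1 f • φ := by
  ext X e : 2
  simp only [homOp_apply, LinearMap.add_apply, LinearMap.smul_apply, P.leibniz]; module

/-- The value `(dω)(Y, Z) = ∇_Y (ω(Z)) - ∇_Z (ω(Y)) - ω([Y, Z])`. -/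
def d1Val (w : Omega1 D K) (Y Z : D.SSec) : Omega0 D K :=
  P.homOp Y (w Z) - P.homOp Z (w Y) - w (D.br Y Z)

theorem d1Val_swap (w : Omega1 D K) (Y Z : D.SSec) :
    P.d1Val w Y Z = -P.d1Val w Z Y := by
  simp only [d1Val, br_swap D Y Z, map_neg]; abel

theorem d1Val_add_right (w : Omega1 D K) (Y Z W : D.SSec) :
    P.d1Val w Y (Z + W) = P.d1Val w Y Z + P.d1Val w Y W := by
  have h : P.homOp (Z + W) (w Y) = P.homOp Z (w Y) + P.homOp W (w Y) :=
    map_add (P.d0 (w Y)) Z W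
  simp only [d1Val, map_add, homOp_add, br_add_right, h]; abel

theorem d1Val_smul_right (w : Omega1 D K) (f : Fn EM M) (Y Z : D.SSec) :
    P.d1Val w Y (f • Z) = f • P.d1Val w Y Z := by
  have h : P.homOp (f • Z) (w Y) = f • P.homOp Z (w Y) := map_smul (P.d0 (w Y)) f Z
  simp only [d1Val, map_smul, map_add, homOp_smul, br_smul_right, h]; module

/-- The differential `Ω¹ → Ω²`. -/
def d1 : Omega1 D K →ₗ[ℝ] Omega2 D K where
  toFun w := LinearMap.mk₂ (Fn EM M) (P.d1Val w)
    (fun Y Z W ↦ by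
      rw [d1Val_swap, d1Val_add_right, d1Val_swap P w Y W, d1Val_swap P w Z W]; abel)
    (fun f Y Z ↦ by rw [d1Val_swap, d1Val_smul_right, d1Val_swap P w Y Z]; module)
    (fun Y Z W ↦ P.d1Val_add_right w Y Z W)
    (fun f Y Z ↦ P.d1Val_smul_right w f Y Z)
  map_add' w η := by
    ext Y Z : 2
    simp only [LinearMap.mk₂_apply, LinearMap.add_apply, d1Val, homOp_add]; abel
  map_smul' r w := by
    ext Y Z X e : 4
    simp only [LinearMap.mk₂_apply, LinearMap.smul_apply, LinearMap.sub_apply, d1Val,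
      homOp_apply, P.op_real_smul, RingHom.id_apply]
    module

@[simp] theorem d1_apply (w : Omega1 D K) (Y Z : D.SSec) :
    P.d1 w Y Z = P.homOp Y (w Z) - P.homOp Z (w Y) - w (D.br Y Z) := rfl

set_option maxSynthPendingDepth 6 in
/-- The cohomology space `H¹(D, Hom(TM/D, End(V/K)))`: closed forms modulo exact ones. -/
def H1 : Type _ := LinearMap.ker P.d1 ⧸ (LinearMap.range P.d0).submoduleOf (LinearMap.ker P.d1)

set_option maxSynthPendingDepth 6 in
instance : AddCommGroup P.H1 := inferInstanceAs
  (AddCommGroup (LinearMap.ker P.d1 ⧸ (LinearMap.range P.d0).submoduleOf (LinearMap.ker P.d1)))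

set_option maxSynthPendingDepth 6 in
instance : Module ℝ P.H1 := inferInstanceAs
  (Module ℝ (LinearMap.ker P.d1 ⧸ (LinearMap.range P.d0).submoduleOf (LinearMap.ker P.d1)))

set_option maxSynthPendingDepth 6 in
/-- The cohomology class of a closed `1`-form. -/
def H1.mk (w : LinearMap.ker P.d1) : P.H1 := Submodule.Quotient.mk w

set_option maxSynthPendingDepth 6 in
theorem H1.mk_eq_zero (w : LinearMap.ker P.d1) : H1.mk P w = 0 ↔ ∃ φ, P.d0 φ = w.1 := by
  rw [H1.mk]
  exact Submodule.Quotient.mk_eq_zero _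

end PartialConnection

/-! ### Extensions of a flat partial connection and the Atiyah class -/

section Atiyah

variable {D : InvolutiveSubbundle EM M} {K : Subbundle EM F V}

/-- A linear connection on `V` is an extension of `P` if it restricts to `K` and if the induced
connection on `V/K` coincides with `P` along `D`. -/
structure IsExtension (P : PartialConnection D K) (N : LinearConnection EM F V) : Prop where
  restricts : ∀ X, ∀ e ∈ K.sections, N.op X e ∈ K.sections
  extends_op : ∀ (Y : D.SSec) (e : Sec EM F V), K.proj (N.op Y.1 e) = P.op Y (K.proj e)

namespace IsExtension

variable {P : PartialConnection D K} {N : LinearConnection EM F V}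

theorem curv_mem (h : IsExtension P N) (X Y : VF EM M) {e : Sec EM F V} (he : e ∈ K.sections) :
    N.curv X Y e ∈ K.sections :=
  K.sections.sub_mem (K.sections.sub_mem (h.restricts _ _ (h.restricts _ _ he))
    (h.restricts _ _ (h.restricts _ _ he))) (h.restricts _ _ he)

theorem proj_curv_eq_zero (h : IsExtension P N) (hP : P.IsFlat) (Y Z : D.SSec)
    (e : Sec EM F V) : K.proj (N.curv Y.1 Z.1 e) = 0 := by
  have := hP Y Z (K.proj e)
  rw [← h.extends_op, ← h.extends_op, ← h.extends_op, ← h.extends_op, ← h.extends_op,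
    ← map_sub, ← map_sub] at this
  exact this

/-- The map `(X, ē) ↦ R(Y, X)e ‾` for a section `Y` of `D`. -/
def formAux₁ (h : IsExtension P N) (Y X : VF EM M) :
    K.QSec →ₗ[Fn EM M] K.QSec :=
  K.desc
    { toFun := fun e ↦ K.proj (N.curv Y X e)
      map_add' := fun e e' ↦ by rw [N.curv_add_right, map_add]
      map_smul' := fun f e ↦ by rw [N.curv_smul_right, map_smul, RingHom.id_apply] }
    (fun _ he ↦ K.proj_eq_zero.2 (h.curv_mem Y X he))

theorem formAux₁_proj (h : IsExtension P N) (Y X : VF EM M) (e : Sec EM F V) :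
    h.formAux₁ Y X (K.proj e) = K.proj (N.curv Y X e) := by
  rw [formAux₁, Subbundle.desc_proj]; rfl

/-- The map `(X̄, ē) ↦ R(Y, X)e ‾` for a section `Y` of `D`. -/
def formAux₂ (h : IsExtension P N) (hP : P.IsFlat) (Y : D.SSec) : Omega0 D K :=
  D.desc
    { toFun := fun X ↦ h.formAux₁ Y.1 X
      map_add' := fun X X' ↦ by
        ext1 s
        obtain ⟨e, rfl⟩ := K.proj_surjective s
        simp only [LinearMap.add_apply, formAux₁_proj]
        rw [N.curv_swap, N.curv_add_left, N.curv_swap Y.1 X, N.curv_swap Y.1 X', ← map_add]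
        congr 1; abel
      map_smul' := fun f X ↦ by
        ext1 s
        obtain ⟨e, rfl⟩ := K.proj_surjective s
        simp only [LinearMap.smul_apply, formAux₁_proj, RingHom.id_apply]
        rw [N.curv_swap, N.curv_smul_left, N.curv_swap Y.1 X, ← map_smul]
        congr 1; module }
    (fun X hX ↦ by
      ext1 s
      obtain ⟨e, rfl⟩ := K.proj_surjective s
      exact (h.formAux₁_proj Y.1 X e).trans (h.proj_curv_eq_zero hP Y ⟨X, hX⟩ e))

theorem formAux₂_proj (h : IsExtension P N) (hP : P.IsFlat) (Y : D.SSec) (X : VF EM M)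
    (e : Sec EM F V) :
    h.formAux₂ hP Y (D.proj X) (K.proj e) = K.proj (N.curv Y.1 X e) := by
  rw [formAux₂, Subbundle.desc_proj]; exact h.formAux₁_proj Y.1 X e

/-- The Atiyah form `ω_∇ ∈ Ω¹(D, Hom(TM/D, End(V/K)))` of an extension,
`ω_∇(Y)(X̄)(ē) = R_∇(Y, X)e ‾`; see `form_proj`. -/
def form (h : IsExtension P N) (hP : P.IsFlat) : Omega1 D K where
  toFun := h.formAux₂ hP
  map_add' Y Z := by
    ext s t : 2
    obtain ⟨X, rfl⟩ := D.proj_surjective s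
    obtain ⟨e, rfl⟩ := K.proj_surjective t
    simp only [LinearMap.add_apply, formAux₂_proj, Subbundle.ssec_add_val, N.curv_add_left, map_add]
  map_smul' f Y := by
    ext s t : 2
    obtain ⟨X, rfl⟩ := D.proj_surjective s
    obtain ⟨e, rfl⟩ := K.proj_surjective t
    simp only [LinearMap.smul_apply, formAux₂_proj, Subbundle.ssec_smul_val, N.curv_smul_left,
      map_smul, RingHom.id_apply]

/-- The defining formula of the Atiyah form. -/
theorem form_proj (h : IsExtension P N) (hP : P.IsFlat) (Y : D.SSec) (X : VF EM M)
    (e : Sec EM F V) : h.form hP Y (D.proj X) (K.proj e) = K.proj (N.curv Y.1 X e) :=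
  h.formAux₂_proj hP Y X e

theorem form_mem_ker (h : IsExtension P N) (hP : P.IsFlat) :
    h.form hP ∈ LinearMap.ker P.d1 := by
  rw [LinearMap.mem_ker]
  ext Y Z s t : 4
  obtain ⟨X, rfl⟩ := D.proj_surjective s
  obtain ⟨e, rfl⟩ := K.proj_surjective t
  have hbr : (D.br Y Z).1 = bracket Y.1 Z.1 := rfl
  simp only [PartialConnection.d1_apply, LinearMap.sub_apply, PartialConnection.homOp_apply,
    InvolutiveSubbundle.bott_op_proj, form_proj, ← h.extends_op, hbr, LinearMap.zero_apply]
  have h1 : K.proj (N.op X (N.curv Y.1 Z.1 e)) = 0 :=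
    K.proj_eq_zero.2 (h.restricts _ _ (K.proj_eq_zero.1 (h.proj_curv_eq_zero hP Y Z e)))
  have h2 := h.proj_curv_eq_zero hP Y Z (N.op X e)
  rw [← sub_zero (0 : K.QSec)]
  nth_rw 1 [← h2]
  rw [← h1]
  simp only [← map_sub]
  congr 1
  simp only [LinearConnection.curv, N.op_sub, bracket_leibniz Y.1 Z.1 X, N.add_left]
  abel

end IsExtension

/-- The Atiyah class `[ω_∇] ∈ H¹(D, Hom(TM/D, End(V/K)))` computed with an extension `N`. -/
def atiyahClass (P : PartialConnection D K) (hP : P.IsFlat) (N : LinearConnection EM F V)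
    (hN : IsExtension P N) : P.H1 :=
  PartialConnection.H1.mk P ⟨hN.form hP, hN.form_mem_ker hP⟩

end Atiyah

/-! ### The quotient `(V/K)/∇` and fibrations of vector bundles -/

namespace PartialConnection

variable {D : InvolutiveSubbundle EM M} {K : Subbundle EM F V} (P : PartialConnection D K)

/-- A section `u` of `V/K` along a curve `c` is parallel at time `t₀`. Near `t₀` one writes
`u = ∑ fᵢ sᵢ(c)` with functions `fᵢ` and sections `sᵢ` of `V/K`; then
`∇u/dt = ∑ fᵢ' sᵢ(c) + fᵢ (∇_Y sᵢ)(c)` for any section `Y` of `D` through the velocity of `c`. In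
particular the velocity of `c` at `t₀` lies in `D`. -/
def IsParallelAt (c : ℝ → M) (u : ∀ t, V (c t) ⧸ K.fiber (c t)) (t₀ : ℝ) : Prop :=
  ∃ (n : ℕ) (f : Fin n → ℝ → ℝ) (s : Fin n → K.QSec) (Y : D.SSec),
    (∀ i, DifferentiableAt ℝ (f i) t₀) ∧
    (∀ᶠ t in 𝓝 t₀, u t = ∑ i, f i t • s i (c t)) ∧
    Y.1 (c t₀) = mfderiv 𝓘(ℝ, ℝ) 𝓘(ℝ, EM) c t₀ (1 : ℝ) ∧
    ∑ i, (deriv (f i) t₀ • s i (c t₀) + f i t₀ • P.op Y (s i) (c t₀)) = 0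

/-- `q` is obtained from `p` by parallel transport along a smooth path, defined on `[0, 1]`, in a
leaf of `D`. -/
def Transport (p q : Σ x : M, V x ⧸ K.fiber x) : Prop :=
  ∃ (c : ℝ → M) (u : ∀ t, V (c t) ⧸ K.fiber (c t)),
    (∀ t ∈ Icc (0 : ℝ) 1, ContMDiffAt 𝓘(ℝ, ℝ) 𝓘(ℝ, EM) ∞ c t ∧ P.IsParallelAt c u t) ∧
    p = ⟨c 0, u 0⟩ ∧ q = ⟨c 1, u 1⟩

/-- The equivalence relation on the total space of `V/K` generated by parallel transport along
paths in the leaves of `D`; its quotient is `(V/K)/∇`. -/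
def TransportEquiv : (Σ x : M, V x ⧸ K.fiber x) → (Σ x : M, V x ⧸ K.fiber x) → Prop :=
  Relation.EqvGen P.Transport

end PartialConnection

/-- A fibration of vector bundles: a smooth map `V → V'` that is fibrewise linear and
surjective, over a surjective submersion `M → M'` with connected fibres. -/
structure Fibration (EM : Type*) [NormedAddCommGroup EM] [NormedSpace ℝ EM]
    {M : Type*} [TopologicalSpace M] [ChartedSpace EM M]
    (F : Type*) [NormedAddCommGroup F] [NormedSpace ℝ F]
    (V : M → Type*) [∀ x, AddCommGroup (V x)] [∀ x, Module ℝ (V x)]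
    [∀ x, TopologicalSpace (V x)] [TopologicalSpace (TotalSpace F V)] [FiberBundle F V]
    (EM' : Type*) [NormedAddCommGroup EM'] [NormedSpace ℝ EM']
    {M' : Type*} [TopologicalSpace M'] [ChartedSpace EM' M']
    (F' : Type*) [NormedAddCommGroup F'] [NormedSpace ℝ F']
    (V' : M' → Type*) [∀ x, AddCommGroup (V' x)] [∀ x, Module ℝ (V' x)]
    [∀ x, TopologicalSpace (V' x)] [TopologicalSpace (TotalSpace F' V')]
    [FiberBundle F' V'] where
  /-- The base map `M → M'`. -/
  base : M → M'
  /-- The linear maps between the fibres. -/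
  map : ∀ x, V x →ₗ[ℝ] V' (base x)
  base_surjective : Function.Surjective base
  base_submersion : IsSubmersion 𝓘(ℝ, EM) 𝓘(ℝ, EM') ∞ base
  base_fibers_connected : ∀ y, IsConnected (base ⁻¹' {y})
  smooth : ContMDiff (𝓘(ℝ, EM).prod 𝓘(ℝ, F)) (𝓘(ℝ, EM').prod 𝓘(ℝ, F')) ∞
    (fun p : TotalSpace F V ↦ (⟨base p.proj, map p.proj p.2⟩ : TotalSpace F' V'))
  map_surjective : ∀ x, Function.Surjective (map x)

/-- The fibration `Φ : V → V'` over `M → M'` is the quotient map `V → (V/K)/∇` over `M → M/D`. -/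
structure IsInducedFibration {D : InvolutiveSubbundle EM M} {K : Subbundle EM F V}
    (P : PartialConnection D K)
    {EM' : Type*} [NormedAddCommGroup EM'] [NormedSpace ℝ EM']
    {M' : Type*} [TopologicalSpace M'] [ChartedSpace EM' M']
    {F' : Type*} [NormedAddCommGroup F'] [NormedSpace ℝ F']
    {V' : M' → Type*} [∀ x, AddCommGroup (V' x)] [∀ x, Module ℝ (V' x)]
    [∀ x, TopologicalSpace (V' x)] [TopologicalSpace (TotalSpace F' V')]
    [FiberBundle F' V'] (Φ : Fibration EM F V EM' F' V') : Prop where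
  /-- The fibres of the base map, which are connected embedded submanifolds with tangent spaces
  the kernels of its differential, are the leaves of `D`. -/
  leaves : ∀ (x : M) (v : TangentSpace 𝓘(ℝ, EM) x),
    mfderiv 𝓘(ℝ, EM) 𝓘(ℝ, EM') Φ.base x v = 0 ↔ v ∈ D.fiber x
  /-- Two vectors are identified exactly if their classes are equivalent under transport. -/
  identifies : ∀ (x y : M) (e : V x) (e' : V y),
    (⟨Φ.base x, Φ.map x e⟩ : TotalSpace F' V') = ⟨Φ.base y, Φ.map y e'⟩ ↔
      P.TransportEquiv ⟨x, (K.fiber x).mkQ e⟩ ⟨y, (K.fiber y).mkQ e'⟩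

end VBAtiyah

end

noncomputable section

open Bundle Set Filter Manifold
open scoped Topology

set_option linter.unusedSectionVars false
set_option linter.unusedVariables false

namespace VBAtiyah

/-! ### Cut-off functions and local frames -/

section Frames

variable {EM : Type*} [NormedAddCommGroup EM] [NormedSpace ℝ EM] [FiniteDimensional ℝ EM]
  {M : Type*} [TopologicalSpace M] [ChartedSpace EM M] [IsManifold 𝓘(ℝ, EM) ∞ M] [T2Space M]
  {F : Type*} [NormedAddCommGroup F] [NormedSpace ℝ F]
  {V : M → Type*} [∀ x, AddCommGroup (V x)] [∀ x, Module ℝ (V x)]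
  [∀ x, TopologicalSpace (V x)] [TopologicalSpace (TotalSpace F V)] [FiberBundle F V]
  [VectorBundle ℝ F V]

/-! The Atiyah forms of two extensions differ by the coboundary of their difference
(`IsExtension.d0_diff`). So it suffices to find one extension `∇⁰` for which `R(Y, X)e` lies in `K`
whenever `Y` lies in `F_M` (`atiyahClass_eq`).

Such an extension comes from the quotient. Fibrewise the kernel of `φ` is `K`, so `φ` makes `E/K`
the pullback of `E'` along `φ₀`. Take any linear connection on `E'` and pull it back. Its curvature
vanishes as soon as one argument is tangent to the fibres of `φ₀`, that is, lies in `F_M`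
(`FrameAtlas.pullback_curv_eq_zero`). A right inverse of `Γ(E) → Γ(φ₀^* E')` lifts the pullback
connection to a connection on `E` that preserves `K` and induces the pullback connection on `E/K`
(`liftConnection`).

The link with `∇^p` is known only through parallel transport, and it is used twice. Uniqueness for
linear differential equations shows that transport preserves vanishing, which gives `ker φ = K`
(`IsInducedFibration.map_eq_zero_iff`). Existence of transport along integral curves shows that a
fibrewise linear function on `E/K` that is invariant under transport intertwines `∇^p_Y` with `Y`
(`PartialConnection.lieD_eq_of_transport`). Applied to the pulled back coordinates of `E'`, this
says that the pullback connection restricts to `∇^p` along `F_M`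
(`IsInducedFibration.pullback_op_secMap`).

All operators act on global sections, so local formulas appear multiplied by cut-off functions `χ`
and are reassembled with partitions of unity `ρ` satisfying `ρ χ = ρ`. -/

theorem exists_cutoff {x : M} {U : Set M} (hU : U ∈ 𝓝 x) :
    ∃ χ : Fn EM M, tsupport χ ⊆ U ∧ ∀ᶠ y in 𝓝 x, χ y = 1 := by
  obtain ⟨f, -, hf⟩ := (SmoothBumpFunction.nhds_basis_tsupport (I := 𝓘(ℝ, EM)) x).mem_iff.1 hU
  exact ⟨⟨f, f.contMDiff⟩, hf, f.eventuallyEq_one⟩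

/-- The pointwise proportionality to `s` ensures that extending a section of a subbundle gives a
section of the same subbundle. -/
theorem exists_sec_eventuallyEq {x : M} {U : Set M} (hU : IsOpen U) (hx : x ∈ U) {s : ∀ y, V y}
    (hs : ContMDiffOn 𝓘(ℝ, EM) (𝓘(ℝ, EM).prod 𝓘(ℝ, F)) ∞
      (fun y ↦ (⟨y, s y⟩ : TotalSpace F V)) U) :
    ∃ S : Sec EM F V, (∀ y ∉ U, S y = 0) ∧ (∀ y, ∃ r : ℝ, S y = r • s y) ∧
      ∀ᶠ y in 𝓝 x, S y = s y := by
  obtain ⟨χ, hχ, hχ1⟩ := exists_cutoff (EM := EM) (hU.mem_nhds hx)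
  refine ⟨⟨fun y ↦ χ y • s y,
    ContMDiffOn.smul_section_of_tsupport χ.contMDiff.contMDiffOn hU hχ hs⟩, fun y hy ↦ ?_,
    fun y ↦ ⟨χ y, rfl⟩, ?_⟩
  · have : χ y = 0 := image_eq_zero_of_notMem_tsupport fun h ↦ hy (hχ h)
    change χ y • s y = 0
    rw [this, zero_smul]
  · filter_upwards [hχ1] with y hy
    change χ y • s y = s y
    rw [hy, one_smul]

theorem exists_smul_eq_of_tsupport {U : Set M} (hU : IsOpen U) (χ : Fn EM M) (hχ : tsupport χ ⊆ U)
    {f : M → ℝ} (hf : ContMDiffOn 𝓘(ℝ, EM) 𝓘(ℝ, ℝ) ∞ f U) :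
    ContMDiff 𝓘(ℝ, EM) 𝓘(ℝ, ℝ) ∞ fun y ↦ χ y * f y := by
  intro y
  by_cases hy : y ∈ U
  · exact χ.contMDiff.contMDiffAt.mul (hf.contMDiffAt (hU.mem_nhds hy))
  · have : y ∈ (tsupport χ)ᶜ := fun h ↦ hy (hχ h)
    refine (contMDiffAt_const (c := (0 : ℝ))).congr_of_eventuallyEq ?_
    filter_upwards [(isClosed_tsupport χ).isOpen_compl.mem_nhds this] with z hz
    rw [image_eq_zero_of_notMem_tsupport hz, zero_mul]

variable [ContMDiffVectorBundle ∞ F V 𝓘(ℝ, EM)]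

theorem exists_sec_apply_eq (x : M) (v : V x) : ∃ S : Sec EM F V, S x = v := by
  obtain ⟨U, hU, hs⟩ := FiberBundle.exists_contMDiffOn_extend (I := 𝓘(ℝ, EM)) (k := ∞) (F := F) v
  obtain ⟨U', hU', hU'o, hx⟩ := mem_nhds_iff.1 hU
  obtain ⟨S, -, -, hS⟩ := exists_sec_eventuallyEq hU'o hx (hs.mono hU')
  exact ⟨S, by rw [hS.self_of_nhds, FiberBundle.extend_apply_self]⟩

theorem finiteDimensional_fiber [FiniteDimensional ℝ F] (x : M) : FiniteDimensional ℝ (V x) :=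
  ((trivializationAt F V x).linearEquivAt ℝ x
    (FiberBundle.mem_baseSet_trivializationAt' x)).symm.finiteDimensional

variable {ι : Type*} [Fintype ι]

/-- The linear map `a ↦ ∑ aᵢ eᵢ(y)` in the trivialization at `x`. -/
def frameMap (F : Type*) [NormedAddCommGroup F] [NormedSpace ℝ F]
    {V : M → Type*} [∀ x, AddCommGroup (V x)] [∀ x, Module ℝ (V x)]
    [∀ x, TopologicalSpace (V x)] [TopologicalSpace (TotalSpace F V)] [FiberBundle F V]
    (x : M) (e : ι → ∀ y, V y) (y : M) : (ι → ℝ) →L[ℝ] F :=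
  ∑ i, (ContinuousLinearMap.proj (R := ℝ) (φ := fun _ : ι ↦ ℝ) i).smulRight
    ((trivializationAt F V x) ⟨y, e i y⟩).2

theorem frameMap_apply {x y : M} (hy : y ∈ (trivializationAt F V x).baseSet)
    (e : ι → ∀ y, V y) (a : ι → ℝ) :
    frameMap F x e y a = (trivializationAt F V x).continuousLinearEquivAt ℝ y hy
      (∑ i, a i • e i y) := by
  simp [frameMap]

theorem contMDiffAt_frameMap {x y : M} (hy : y ∈ (trivializationAt F V x).baseSet)
    {e : ι → ∀ y, V y} (he : ∀ i, ContMDiffAt 𝓘(ℝ, EM) (𝓘(ℝ, EM).prod 𝓘(ℝ, F)) ∞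
      (fun z ↦ (⟨z, e i z⟩ : TotalSpace F V)) y) :
    ContMDiffAt 𝓘(ℝ, EM) 𝓘(ℝ, (ι → ℝ) →L[ℝ] F) ∞ (frameMap F x e) y := by
  unfold frameMap
  refine contMDiffAt_finsetSum fun i _ ↦ ?_
  have h := ((trivializationAt F V x).contMDiffAt_section_iff hy).1 (he i)
  exact ((ContinuousLinearMap.smulRightL ℝ (ι → ℝ) F
    (ContinuousLinearMap.proj i)).contDiff.contMDiff.contMDiffAt).comp y h

/-- Being a basis of the fibre becomes invertibility of an operator between fixed spaces, a
condition that is open and under which inversion is smooth. -/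
theorem exists_equiv_frameMap {x y : M} (hy : y ∈ (trivializationAt F V x).baseSet)
    {e : ι → ∀ y, V y} (h1 : LinearIndependent ℝ fun i ↦ e i y)
    (h2 : ⊤ ≤ Submodule.span ℝ (range fun i ↦ e i y)) :
    ∃ A : (ι → ℝ) ≃L[ℝ] F, (A : (ι → ℝ) →L[ℝ] F) = frameMap F x e y := by
  have e1 : (ι → ℝ) ≃ₗ[ℝ] F := (Module.Basis.mk h1 h2).equivFun.symm ≪≫ₗ
    ((trivializationAt F V x).continuousLinearEquivAt ℝ y hy).toLinearEquiv
  have : FiniteDimensional ℝ F := e1.finiteDimensional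
  refine ⟨((Module.Basis.mk h1 h2).equivFun.symm ≪≫ₗ
    ((trivializationAt F V x).continuousLinearEquivAt ℝ y hy).toLinearEquiv).toContinuousLinearEquiv,
    ?_⟩
  ext1 a
  rw [frameMap_apply hy]
  simp [Module.Basis.equivFun_symm_apply]

/-- Sections that form a basis of a fibre form a local frame. -/
theorem exists_isLocalFrameOn {x : M} {e : ι → Sec EM F V}
    (h1 : LinearIndependent ℝ fun i ↦ e i x)
    (h2 : ⊤ ≤ Submodule.span ℝ (range fun i ↦ e i x)) :
    ∃ U : Set M, IsOpen U ∧ x ∈ U ∧ IsLocalFrameOn 𝓘(ℝ, EM) F ∞ (fun i y ↦ e i y) U := by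
  have hx := FiberBundle.mem_baseSet_trivializationAt' (F := F) (E := V) x
  obtain ⟨A, hA⟩ := exists_equiv_frameMap (e := fun i y ↦ e i y) hx h1 h2
  have hc : ContinuousAt (frameMap F x fun i y ↦ e i y) x :=
    (contMDiffAt_frameMap hx fun i ↦ (e i).contMDiff.contMDiffAt).continuousAt
  -- The invertible operators are open among the continuous linear ones, so invertibility at `x`
  -- persists nearby.
  have hev : ∀ᶠ y in 𝓝 x, y ∈ (trivializationAt F V x).baseSet ∧
      frameMap F x (fun i y ↦ e i y) y ∈ range ((↑) : ((ι → ℝ) ≃L[ℝ] F) → (ι → ℝ) →L[ℝ] F) := by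
    have h := hc.preimage_mem_nhds (hA ▸ A.nhds)
    filter_upwards [(trivializationAt F V x).open_baseSet.mem_nhds hx, h] with y hy hy'
    exact ⟨hy, hy'⟩
  obtain ⟨U, hU, hUo, hxU⟩ := eventually_nhds_iff.1 hev
  refine ⟨U, hUo, hxU, ?_, ?_, fun i ↦ (e i).contMDiff.contMDiffOn⟩
  · intro y hy
    obtain ⟨hyb, B, hB⟩ := hU y hy
    rw [Fintype.linearIndependent_iff]
    intro a ha
    have : B a = 0 := by
      have := DFunLike.congr_fun hB a
      rw [frameMap_apply hyb, ha, map_zero] at this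
      exact this
    have : a = 0 := by simpa using this
    simp [this]
  · intro y hy v _
    obtain ⟨hyb, B, hB⟩ := hU y hy
    have := DFunLike.congr_fun hB (B.symm ((trivializationAt F V x).continuousLinearEquivAt ℝ y hyb v))
    rw [frameMap_apply hyb] at this
    simp only [ContinuousLinearEquiv.coe_coe, ContinuousLinearEquiv.apply_symm_apply,
      EmbeddingLike.apply_eq_iff_eq] at this
    rw [this]
    exact Submodule.sum_mem _ fun i _ ↦ Submodule.smul_mem _ _ (Submodule.subset_span ⟨i, rfl⟩)

/-- Near `x` the coefficients are the inverse of `frameMap` applied to the trivialized section, and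
inversion of operators is smooth at an invertible one. -/
theorem contMDiffAt_coeff {e : ι → ∀ y, V y} {U : Set M}
    (h : IsLocalFrameOn 𝓘(ℝ, EM) F ∞ e U) (hU : IsOpen U) {x : M} (hx : x ∈ U) {s : ∀ y, V y}
    (hs : ContMDiffAt 𝓘(ℝ, EM) (𝓘(ℝ, EM).prod 𝓘(ℝ, F)) ∞
      (fun z ↦ (⟨z, s z⟩ : TotalSpace F V)) x) (i : ι) :
    ContMDiffAt 𝓘(ℝ, EM) 𝓘(ℝ, ℝ) ∞ (fun y ↦ h.coeff i y (s y)) x := by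
  have hxb := FiberBundle.mem_baseSet_trivializationAt' (F := F) (E := V) x
  obtain ⟨A, hA⟩ := exists_equiv_frameMap (e := e) hxb (h.linearIndependent hx) (h.generating hx)
  have h1 : ContMDiffAt 𝓘(ℝ, EM) 𝓘(ℝ, F →L[ℝ] (ι → ℝ)) ∞
      (fun y ↦ ContinuousLinearMap.inverse (frameMap F x e y)) x := by
    have := contDiffAt_map_inverse (n := ∞) A
    rw [hA] at this
    exact this.contMDiffAt.comp x (contMDiffAt_frameMap hxb fun i ↦ h.contMDiffAt hU hx i)
  have h2 := h1.clm_apply (((trivializationAt F V x).contMDiffAt_section_iff hxb).1 hs)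
  have h3 : ContMDiffAt 𝓘(ℝ, EM) 𝓘(ℝ, ℝ) ∞ (fun y ↦ ContinuousLinearMap.inverse (frameMap F x e y)
      ((trivializationAt F V x) ⟨y, s y⟩).2 i) x :=
    ((ContinuousLinearMap.proj (R := ℝ) (φ := fun _ : ι ↦ ℝ) i).contDiff.contMDiff.contMDiffAt).comp
      x h2
  refine h3.congr_of_eventuallyEq ?_
  filter_upwards [hU.mem_nhds hx, (trivializationAt F V x).open_baseSet.mem_nhds hxb] with y hy hyb
  obtain ⟨B, hB⟩ := exists_equiv_frameMap (e := e) hyb (h.linearIndependent hy) (h.generating hy)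
  rw [← hB, ContinuousLinearMap.inverse_equiv]
  have : ((trivializationAt F V x) ⟨y, s y⟩).2 = B fun i ↦ h.coeff i y (s y) := by
    have := DFunLike.congr_fun hB fun i ↦ h.coeff i y (s y)
    rw [frameMap_apply hyb, ← h.coeff_sum_eq s hy] at this
    rw [← ContinuousLinearEquiv.coe_coe, this]
    simp
  rw [this]
  simp

/-- The coefficients of sections in a local frame, multiplied by a cut-off function. -/
def frameCoeff {e : ι → ∀ y, V y} {U : Set M} (h : IsLocalFrameOn 𝓘(ℝ, EM) F ∞ e U)
    (hU : IsOpen U) (χ : Fn EM M) (hχ : tsupport χ ⊆ U) (i : ι) : Sec EM F V →ₗ[Fn EM M] Fn EM M where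
  toFun s := ⟨fun y ↦ χ y * h.coeff i y (s y), exists_smul_eq_of_tsupport hU χ hχ fun y hy ↦
    (contMDiffAt_coeff h hU hy s.contMDiff.contMDiffAt i).contMDiffWithinAt⟩
  map_add' s t := by
    ext y
    change χ y * h.coeff i y (s y + t y) = χ y * h.coeff i y (s y) + χ y * h.coeff i y (t y)
    rw [map_add, mul_add]
  map_smul' f s := by
    ext y
    change χ y * h.coeff i y (f y • s y) = f y * (χ y * h.coeff i y (s y))
    rw [map_smul, smul_eq_mul]
    ring

theorem frameCoeff_apply {e : ι → ∀ y, V y} {U : Set M} (h : IsLocalFrameOn 𝓘(ℝ, EM) F ∞ e U)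
    (hU : IsOpen U) (χ : Fn EM M) (hχ : tsupport χ ⊆ U) (i : ι) (s : Sec EM F V) (y : M) :
    frameCoeff h hU χ hχ i s y = χ y * h.coeff i y (s y) := rfl

theorem sec_sum_apply {κ : Type*} (t : Finset κ) (s : κ → Sec EM F V) (y : M) :
    (∑ i ∈ t, s i) y = ∑ i ∈ t, s i y :=
  map_sum ({ toFun := fun s ↦ s y, map_zero' := rfl, map_add' := fun _ _ ↦ rfl } :
    Sec EM F V →+ V y) s t

theorem sum_frameCoeff {e : ι → Sec EM F V} {U : Set M}
    (h : IsLocalFrameOn 𝓘(ℝ, EM) F ∞ (fun i y ↦ e i y) U)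
    (hU : IsOpen U) (χ : Fn EM M) (hχ : tsupport χ ⊆ U) (s : Sec EM F V) :
    ∑ i, frameCoeff h hU χ hχ i s • e i = χ • s := by
  ext y
  rw [sec_sum_apply]
  simp only [sec_smul_apply, frameCoeff_apply, mul_smul]
  rw [← Finset.smul_sum]
  by_cases hy : y ∈ U
  · rw [← h.coeff_sum_eq (fun y ↦ s y) hy]
  · rw [image_eq_zero_of_notMem_tsupport fun h ↦ hy (hχ h), zero_smul, zero_smul]

/-- Around every point there is a local frame given by global sections. -/
theorem exists_frame [FiniteDimensional ℝ F] (x : M) :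
    ∃ (n : ℕ) (e : Fin n → Sec EM F V) (U : Set M), IsOpen U ∧ x ∈ U ∧
      IsLocalFrameOn 𝓘(ℝ, EM) F ∞ (fun i y ↦ e i y) U := by
  have : FiniteDimensional ℝ (V x) := finiteDimensional_fiber (F := F) x
  choose S hS using exists_sec_apply_eq (EM := EM) (F := F) (V := V) x
  let b := Module.finBasis ℝ (V x)
  have hb : (fun i ↦ S (b i) x) = b := funext fun i ↦ hS _
  exact ⟨_, fun i ↦ S (b i), exists_isLocalFrameOn (by rw [hb]; exact b.linearIndependent)
    (by rw [hb]; exact b.span_eq.ge)⟩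

end Frames

/-! ### Coordinates, partitions of unity and gluing -/

section Gluing

variable {EM : Type*} [NormedAddCommGroup EM] [NormedSpace ℝ EM]
  {M : Type*} [TopologicalSpace M] [ChartedSpace EM M]
  {F : Type*} [NormedAddCommGroup F] [NormedSpace ℝ F]
  {V : M → Type*} [∀ x, AddCommGroup (V x)] [∀ x, Module ℝ (V x)]
  [∀ x, TopologicalSpace (V x)] [TopologicalSpace (TotalSpace F V)] [FiberBundle F V]
  [VectorBundle ℝ F V]

/-- The sum `∑ᵢ ρᵢ sᵢ` of sections over a locally finite family of functions. -/
def glue {ι : Type*} (ρ : ι → Fn EM M) (hρ : LocallyFinite fun i ↦ Function.support (ρ i)) :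
    (ι → Sec EM F V) →ₗ[Fn EM M] Sec EM F V where
  toFun T := ⟨fun x ↦ ∑ᶠ i, ρ i x • T i x, by
    refine ContMDiff.finsum_section_of_locallyFinite (hρ.subset fun i x hx ↦ ?_)
      fun i ↦ (ρ i • T i).contMDiff
    exact left_ne_zero_of_smul hx⟩
  map_add' T T' := by
    ext x
    change ∑ᶠ i, ρ i x • (T i x + T' i x) = ∑ᶠ i, ρ i x • T i x + ∑ᶠ i, ρ i x • T' i x
    rw [← finsum_add_distrib]
    · simp only [smul_add]
    · exact (hρ.point_finite x).subset fun i hi ↦ left_ne_zero_of_smul hi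
    · exact (hρ.point_finite x).subset fun i hi ↦ left_ne_zero_of_smul hi
  map_smul' f T := by
    ext x
    change ∑ᶠ i, ρ i x • (f x • T i x) = f x • ∑ᶠ i, ρ i x • T i x
    rw [smul_finsum' _ ((hρ.point_finite x).subset fun i hi ↦ left_ne_zero_of_smul hi)]
    exact finsum_congr fun i ↦ smul_comm _ _ _

theorem glue_apply {ι : Type*} (ρ : ι → Fn EM M) (hρ : LocallyFinite fun i ↦ Function.support (ρ i))
    (T : ι → Sec EM F V) (x : M) : glue ρ hρ T x = ∑ᶠ i, ρ i x • T i x := rfl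

/-- The cut-offs are absorbed by the partition of unity, so expansions of `χ i • s` in local frames
glue back to `s`. -/
theorem glue_smul_eq {ι : Type*} (ρ χ : ι → Fn EM M) (hρ : LocallyFinite fun i ↦ Function.support (ρ i))
    (h : ∀ i, ρ i * χ i = ρ i) (h1 : ∀ x, ∑ᶠ i, ρ i x = 1) (s : Sec EM F V) :
    glue ρ hρ (fun i ↦ χ i • s) = s := by
  ext x
  rw [glue_apply]
  have : ∀ i, ρ i x • (χ i • s) x = ρ i x • s x := fun i ↦ by
    rw [sec_smul_apply, smul_smul]
    congr 1
    exact DFunLike.congr_fun (h i) x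
  simp only [this]
  rw [← finsum_smul' ((hρ.point_finite x)), h1, one_smul]

variable [IsManifold 𝓘(ℝ, EM) ∞ M]

theorem lieD_add_right (X : VF EM M) (f g : Fn EM M) : lieD X (f + g) = lieD X f + lieD X g := by
  ext x
  have h := mvfderiv_add (x := x) (f.contMDiff.mdifferentiable (by simp) x)
    (g.contMDiff.mdifferentiable (by simp) x)
  exact DFunLike.congr_fun h (X x)

theorem lieD_mul (X : VF EM M) (f g : Fn EM M) :
    lieD X (f * g) = f * lieD X g + lieD X f * g := by
  ext x
  have h := mvfderiv_mul (x := x) (f.contMDiff.mdifferentiable (by simp) x)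
    (g.contMDiff.mdifferentiable (by simp) x)
  refine (DFunLike.congr_fun h (X x)).trans ?_
  change f x * lieD X g x + g x * lieD X f x = f x * lieD X g x + lieD X f x * g x
  ring

variable [FiniteDimensional ℝ EM] [T2Space M]

theorem exists_partition [SigmaCompactSpace M] (U : M → Set M) (hU : ∀ x, U x ∈ 𝓝 x) :
    ∃ χ ρ : M → Fn EM M, (∀ i, tsupport (χ i) ⊆ U i) ∧ (∀ i, ρ i * χ i = ρ i) ∧
      (LocallyFinite fun i ↦ Function.support (ρ i)) ∧ ∀ x, ∑ᶠ i, ρ i x = 1 := by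
  choose χ hχ hχ1 using fun x ↦ exists_cutoff (EM := EM) (hU x)
  -- Subordination to the smaller sets `W x`, where `χ x = 1`, is what yields `ρ χ = ρ`.
  choose W hW hWo hxW using fun x ↦ eventually_nhds_iff.1 (hχ1 x)
  obtain ⟨ρ, hρ⟩ := SmoothPartitionOfUnity.exists_isSubordinate 𝓘(ℝ, EM) isClosed_univ W hWo
    (fun x _ ↦ mem_iUnion.2 ⟨x, hxW x⟩)
  refine ⟨χ, ρ, hχ, fun i ↦ ?_, ρ.locallyFinite, fun x ↦ ρ.sum_eq_one (mem_univ x)⟩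
  ext x
  change ρ i x * χ i x = ρ i x
  by_cases hx : ρ i x = 0
  · rw [hx, zero_mul]
  · rw [hW i x (hρ i (subset_tsupport _ hx)), mul_one]

/-- This is `X = ∑ X(xˡ) ∂ₗ` in a chart, made global: `c` are cut-off coordinates and `Z` are
cut-off coordinate fields. -/
theorem exists_coordinates (x₀ : M) : ∃ (χ : Fn EM M) (n : ℕ) (c : Fin n → Fn EM M)
    (Z : Fin n → VF EM M), (∀ᶠ y in 𝓝 x₀, χ y = 1) ∧
      ∀ X : VF EM M, χ • X = ∑ l, lieD X (c l) • Z l := by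
  let b := Module.finBasis ℝ EM
  let T := trivializationAt EM (TangentSpace 𝓘(ℝ, EM) : M → Type _) x₀
  have hTb : T.baseSet = (chartAt EM x₀).source := TangentBundle.trivializationAt_baseSet x₀
  have hTo : IsOpen T.baseSet := T.open_baseSet
  have hx₀ : x₀ ∈ T.baseSet := FiberBundle.mem_baseSet_trivializationAt' x₀
  obtain ⟨χ₁, hχ₁, h₁⟩ := exists_cutoff (EM := EM) (hTo.mem_nhds hx₀)
  obtain ⟨W, hW, hWo, hxW⟩ := eventually_nhds_iff.1 h₁
  -- The second cut-off is supported where `χ₁ = 1`. There the functions `c l` have the same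
  -- derivatives as the chart coordinates.
  obtain ⟨χ, hχ, h⟩ := exists_cutoff (EM := EM) ((hWo.inter hTo).mem_nhds ⟨hxW, hx₀⟩)
  let ψ := extChartAt 𝓘(ℝ, EM) x₀
  have hψ : ContMDiffOn 𝓘(ℝ, EM) 𝓘(ℝ, EM) ∞ ψ T.baseSet := by
    rw [hTb]; exact contMDiffOn_extChartAt
  let c : Fin (Module.finrank ℝ EM) → Fn EM M := fun l ↦ ⟨fun y ↦ χ₁ y * b.coord l (ψ y),
    exists_smul_eq_of_tsupport hTo χ₁ hχ₁
      ((b.coord l).toContinuousLinearMap.contDiff.contMDiff.comp_contMDiffOn hψ)⟩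
  let Z : Fin (Module.finrank ℝ EM) → VF EM M := fun l ↦ ⟨fun y ↦ χ y • T.localFrame b l y,
    ContMDiffOn.smul_section_of_tsupport χ.contMDiff.contMDiffOn hTo
      (hχ.trans inter_subset_right) (T.contMDiffOn_localFrame_baseSet ∞ b l)⟩
  refine ⟨χ, _, c, Z, h, fun X ↦ ?_⟩
  ext y
  rw [sec_sum_apply]
  change χ y • X y = ∑ l, lieD X (c l) y • χ y • T.localFrame b l y
  by_cases hy : χ y = 0
  · simp [hy]
  obtain ⟨hyW, hyT⟩ := hχ (subset_tsupport _ hy)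
  have key : ∀ l, lieD X (c l) y = b.coord l (T.continuousLinearMapAt ℝ y (X y)) := by
    intro l
    have hψy : MDifferentiableAt 𝓘(ℝ, EM) 𝓘(ℝ, EM) ψ y :=
      (hψ.contMDiffAt (hTo.mem_nhds hyT)).mdifferentiableAt (by simp)
    have hbl : DifferentiableAt ℝ (b.coord l) (ψ y) :=
      (b.coord l).toContinuousLinearMap.differentiableAt
    have hev : (c l : M → ℝ) =ᶠ[𝓝 y] b.coord l ∘ ψ := by
      filter_upwards [hWo.mem_nhds hyW] with z hz
      change χ₁ z * b.coord l (ψ z) = _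
      rw [hW z hz, one_mul, Function.comp_apply]
    have h1 := hev.mfderiv_eq (I := 𝓘(ℝ, EM)) (I' := 𝓘(ℝ, ℝ))
    rw [mfderiv_comp y hbl.mdifferentiableAt hψy, mfderiv_eq_fderiv] at h1
    -- The tangent bundle is trivialized by the derivative of the chart, so `X(xˡ)` is the `l`-th
    -- component of `X` in the local frame.
    have h2 := TangentBundle.continuousLinearMapAt_trivializationAt (I := 𝓘(ℝ, EM)) (hTb ▸ hyT)
    rw [h2]
    refine (DFunLike.congr_fun h1 (X y)).trans ?_
    have h3 : fderiv ℝ (b.coord l) (ψ y) = (b.coord l).toContinuousLinearMap :=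
      (b.coord l).toContinuousLinearMap.fderiv
    change fderiv ℝ (b.coord l) (ψ y) _ = _
    rw [h3]
    rfl
  simp only [key, smul_comm _ (χ y)]
  rw [← Finset.smul_sum]
  congr 1
  simp only [T.localFrame_apply_of_mem_baseSet b hyT]
  have h4 := (T.basisAt b hyT).sum_repr (X y)
  rw [← h4]
  refine Finset.sum_congr rfl fun l _ ↦ ?_
  congr 1
  rw [h4]
  simp [Trivialization.basisAt, Trivialization.coe_linearMapAt_of_mem _ hyT]

end Gluing

/-! ### Linear connections from frames, and pullbacks -/

section FrameAtlas

/-- Local frames of a vector bundle, given by global sections over the members of an open cover,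
with a partition of unity. -/
structure FrameAtlas (EM : Type*) [NormedAddCommGroup EM] [NormedSpace ℝ EM]
    {M : Type*} [TopologicalSpace M] [ChartedSpace EM M]
    (F : Type*) [NormedAddCommGroup F] [NormedSpace ℝ F]
    (V : M → Type*) [∀ x, AddCommGroup (V x)] [∀ x, Module ℝ (V x)]
    [∀ x, TopologicalSpace (V x)] [TopologicalSpace (TotalSpace F V)] [FiberBundle F V]
    (ι : Type*) where
  /-- The rank. -/
  n : ι → ℕ
  /-- The frames. -/
  e : ∀ i, Fin (n i) → Sec EM F V
  /-- The domains of the frames. -/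
  U : ι → Set M
  isOpen : ∀ i, IsOpen (U i)
  frame : ∀ i, IsLocalFrameOn 𝓘(ℝ, EM) F ∞ (fun a y ↦ e i a y) (U i)
  /-- Cut-off functions. -/
  χ : ι → Fn EM M
  /-- The partition of unity. -/
  ρ : ι → Fn EM M
  tsupport_subset : ∀ i, tsupport (χ i) ⊆ U i
  mul_eq : ∀ i, ρ i * χ i = ρ i
  locallyFinite : LocallyFinite fun i ↦ Function.support (ρ i)
  sum_eq_one : ∀ x, ∑ᶠ i, ρ i x = 1

variable {EM : Type*} [NormedAddCommGroup EM] [NormedSpace ℝ EM] [FiniteDimensional ℝ EM]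
  {M : Type*} [TopologicalSpace M] [ChartedSpace EM M] [IsManifold 𝓘(ℝ, EM) ∞ M] [T2Space M]
  {F : Type*} [NormedAddCommGroup F] [NormedSpace ℝ F]
  {V : M → Type*} [∀ x, AddCommGroup (V x)] [∀ x, Module ℝ (V x)]
  [∀ x, TopologicalSpace (V x)] [TopologicalSpace (TotalSpace F V)] [FiberBundle F V]
  [VectorBundle ℝ F V] [ContMDiffVectorBundle ∞ F V 𝓘(ℝ, EM)]

theorem exists_frameAtlas [FiniteDimensional ℝ F] [SigmaCompactSpace M] :
    Nonempty (FrameAtlas EM F V M) := by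
  choose n e U hU hx he using exists_frame (EM := EM) (F := F) (V := V)
  obtain ⟨χ, ρ, h1, h2, h3, h4⟩ := exists_partition (EM := EM) U fun x ↦ (hU x).mem_nhds (hx x)
  exact ⟨⟨n, e, U, hU, he, χ, ρ, h1, h2, h3, h4⟩⟩

namespace FrameAtlas

variable {ι : Type*} (A : FrameAtlas EM F V ι)

/-- The coefficients of sections. -/
def coeff (i : ι) (a : Fin (A.n i)) : Sec EM F V →ₗ[Fn EM M] Fn EM M :=
  frameCoeff (A.frame i) (A.isOpen i) (A.χ i) (A.tsupport_subset i) a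

theorem sum_coeff (i : ι) (s : Sec EM F V) : ∑ a, A.coeff i a s • A.e i a = A.χ i • s :=
  sum_frameCoeff (A.frame i) (A.isOpen i) (A.χ i) (A.tsupport_subset i) s

/-- Gluing with the partition of unity. -/
def glue : (ι → Sec EM F V) →ₗ[Fn EM M] Sec EM F V := VBAtiyah.glue A.ρ A.locallyFinite

theorem glue_smul (s : Sec EM F V) : A.glue (fun i ↦ A.χ i • s) = s :=
  glue_smul_eq A.ρ A.χ A.locallyFinite A.mul_eq A.sum_eq_one s

/-- The linear connection glued from the flat connections of the frames. -/
def connection : LinearConnection EM F V where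
  op X s := A.glue fun i ↦ ∑ a, lieD X (A.coeff i a s) • A.e i a
  add_left X Y s := by
    rw [← map_add]
    congr 1
    funext i
    simp only [lieD_add_left, add_smul, Finset.sum_add_distrib, Pi.add_apply]
  smul_left f X s := by
    rw [← map_smul]
    congr 1
    funext i
    simp only [lieD_smul_left, mul_smul, Finset.smul_sum, Pi.smul_apply]
  add_right X s t := by
    rw [← map_add]
    congr 1
    funext i
    simp only [map_add, lieD_add_right, add_smul, Finset.sum_add_distrib, Pi.add_apply]
  leibniz X f s := by
    -- In the frame `i` the Leibniz rule produces `X(f) χᵢ s`, since the coefficients carry the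
    -- cut-off; gluing these terms gives `X(f) s`.
    have h : lieD X f • s = A.glue (lieD X f • fun i ↦ A.χ i • s) := by
      rw [map_smul, A.glue_smul]
    rw [h, ← map_smul, ← map_add]
    congr 1
    funext i
    simp only [map_smul, smul_eq_mul, lieD_mul, add_smul, mul_smul, Finset.sum_add_distrib,
      Pi.add_apply, Pi.smul_apply, Finset.smul_sum, ← A.sum_coeff]

theorem connection_op (X : VF EM M) (s : Sec EM F V) :
    A.connection.op X s = A.glue fun i ↦ ∑ a, lieD X (A.coeff i a s) • A.e i a := rfl

end FrameAtlas

end FrameAtlas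

/-! ### Pullback bundles and pullback connections. -/

section Pullback

variable {EM : Type*} [NormedAddCommGroup EM] [NormedSpace ℝ EM] [FiniteDimensional ℝ EM]
  {M : Type*} [TopologicalSpace M] [ChartedSpace EM M] [IsManifold 𝓘(ℝ, EM) ∞ M] [T2Space M]
  {EM' : Type*} [NormedAddCommGroup EM'] [NormedSpace ℝ EM'] [FiniteDimensional ℝ EM']
  {M' : Type*} [TopologicalSpace M'] [ChartedSpace EM' M'] [IsManifold 𝓘(ℝ, EM') ∞ M'] [T2Space M']
  {F' : Type*} [NormedAddCommGroup F'] [NormedSpace ℝ F']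
  {V' : M' → Type*} [∀ x, AddCommGroup (V' x)] [∀ x, Module ℝ (V' x)]
  [∀ x, TopologicalSpace (V' x)] [TopologicalSpace (TotalSpace F' V')] [FiberBundle F' V']
  [VectorBundle ℝ F' V'] [ContMDiffVectorBundle ∞ F' V' 𝓘(ℝ, EM')]
  {F : Type*} [NormedAddCommGroup F] [NormedSpace ℝ F]
  {V : M → Type*} [∀ x, AddCommGroup (V x)] [∀ x, Module ℝ (V x)]
  [∀ x, TopologicalSpace (V x)] [TopologicalSpace (TotalSpace F V)] [FiberBundle F V]
  [VectorBundle ℝ F V]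
  (g : C^∞⟮𝓘(ℝ, EM), M; 𝓘(ℝ, EM'), M'⟯)

instance pullbackAddCommGroup {B B' : Type*} {E : B → Type*} [∀ x, AddCommGroup (E x)]
    (f : B' → B) (x : B') : AddCommGroup ((f *ᵖ E) x) :=
  inferInstanceAs (AddCommGroup (E (f x)))

/-- Sections of the pullback bundle from sections along the map. -/
def secAlong (w : ∀ x, V' (g x)) (hw : ContMDiff 𝓘(ℝ, EM) (𝓘(ℝ, EM').prod 𝓘(ℝ, F')) ∞
    (fun x ↦ (⟨g x, w x⟩ : TotalSpace F' V'))) : Sec EM F' (g *ᵖ V') :=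
  ⟨w, fun x ↦ by
    refine (contMDiffAt_section (F := F') (E := g *ᵖ V') x).2 ?_
    exact (contMDiffAt_totalSpace.1 (hw x)).2⟩

/-- The pullback of a section. -/
def pull (s : Sec EM' F' V') : Sec EM F' (g *ᵖ V') :=
  secAlong g (fun x ↦ s (g x)) (s.contMDiff.comp g.contMDiff)

theorem pull_apply (s : Sec EM' F' V') (x : M) : pull g s x = s (g x) := rfl

theorem pull_sum {κ : Type*} (t : Finset κ) (s : κ → Sec EM' F' V') :
    pull g (∑ i ∈ t, s i) = ∑ i ∈ t, pull g (s i) := by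
  ext x
  rw [sec_sum_apply, pull_apply, sec_sum_apply]
  rfl

theorem pull_smul (f : Fn EM' M') (s : Sec EM' F' V') : pull g (f • s) = f.comp g • pull g s := rfl

theorem lieD_comp (X : VF EM M) (f : Fn EM' M') (x : M) :
    lieD X (f.comp g) x = mvfderiv 𝓘(ℝ, EM') f (g x) (mfderiv 𝓘(ℝ, EM) 𝓘(ℝ, EM') g x (X x)) :=
  mvfderiv_comp_apply x (f.contMDiff.mdifferentiable (by simp) _)
    (g.contMDiff.mdifferentiable (by simp) x) (X x)

/-- The frames of a pullback bundle. -/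
def FrameAtlas.pullback {ι : Type*} (A : FrameAtlas EM' F' V' ι) :
    FrameAtlas EM F' (g *ᵖ V') ι where
  n := A.n
  e i a := pull g (A.e i a)
  U i := g ⁻¹' A.U i
  isOpen i := (A.isOpen i).preimage g.contMDiff.continuous
  frame i :=
    { linearIndependent := fun hx ↦ (A.frame i).linearIndependent hx
      generating := fun hx ↦ (A.frame i).generating hx
      contMDiffOn := fun a ↦ (pull g (A.e i a)).contMDiff.contMDiffOn }
  χ i := (A.χ i).comp g
  ρ i := (A.ρ i).comp g
  tsupport_subset i := (tsupport_comp_subset_preimage _ g.contMDiff.continuous).trans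
    (preimage_mono (A.tsupport_subset i))
  mul_eq i := by
    ext x
    exact DFunLike.congr_fun (A.mul_eq i) (g x)
  locallyFinite := A.locallyFinite.preimage_continuous g.contMDiff.continuous
  sum_eq_one x := A.sum_eq_one (g x)

theorem fn_sum_apply {κ : Type*} (t : Finset κ) (f : κ → Fn EM M) (x : M) :
    (∑ i ∈ t, f i) x = ∑ i ∈ t, f i x :=
  map_sum ({ toFun := fun f ↦ f x, map_zero' := rfl, map_add' := fun _ _ ↦ rfl } :
    Fn EM M →+ ℝ) f t

theorem lieD_zero_right (X : VF EM M) : lieD X (0 : Fn EM M) = 0 := by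
  simpa using lieD_add_right X 0 0

/-- The derivatives of a function, as an additive map. -/
def lieDHom (f : Fn EM M) : VF EM M →+ Fn EM M where
  toFun X := lieD X f
  map_zero' := by
    ext x
    exact map_zero (mvfderiv 𝓘(ℝ, EM) f x)
  map_add' X Y := lieD_add_left X Y f

/-- The fibre at `x`, the frame and the cut-off are by definition those at `g x`. -/
theorem FrameAtlas.pullback_coeff {ι : Type*} (A : FrameAtlas EM' F' V' ι) (i : ι)
    (a : Fin (A.n i)) (s : Sec EM' F' V') :
    (A.pullback g).coeff i a (pull g s) = (A.coeff i a s).comp g := by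
  rfl

theorem FrameAtlas.pullback_glue {ι : Type*} (A : FrameAtlas EM' F' V' ι)
    (T : ι → Sec EM' F' V') :
    (A.pullback g).glue (fun i ↦ pull g (T i)) = pull g (A.glue T) := rfl

theorem lieD_comp_eq_zero {Y : VF EM M}
    (hY : ∀ x, mfderiv 𝓘(ℝ, EM) 𝓘(ℝ, EM') g x (Y x) = 0) (f : Fn EM' M') :
    lieD Y (f.comp g) = 0 := by
  ext x
  rw [lieD_comp, hY, map_zero]
  rfl

/-- Pulled back sections have pulled back coefficients, which are constant in vertical directions.
-/
theorem FrameAtlas.pullback_op_pull_eq_zero {ι : Type*} (A : FrameAtlas EM' F' V' ι) {Y : VF EM M}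
    (hY : ∀ x, mfderiv 𝓘(ℝ, EM) 𝓘(ℝ, EM') g x (Y x) = 0) (s : Sec EM' F' V') :
    (A.pullback g).connection.op Y (pull g s) = 0 := by
  rw [connection_op]
  have h : ∀ i a, lieD Y ((A.pullback g).coeff i a (pull g s)) = 0 :=
    fun i a ↦ (congrArg (lieD Y) (A.pullback_coeff g i a s)).trans (lieD_comp_eq_zero g hY _)
  simp only [h, zero_smul, Finset.sum_const_zero]
  exact map_zero _

theorem lieD_comp_eq_sum [SigmaCompactSpace M'] {χ : Fn EM' M'} {n : ℕ} {c : Fin n → Fn EM' M'}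
    {Z : Fin n → VF EM' M'} (hc : ∀ X : VF EM' M', χ • X = ∑ l, lieD X (c l) • Z l)
    (X : VF EM M) (f : Fn EM' M') :
    χ.comp g * lieD X (f.comp g) = ∑ l, lieD X ((c l).comp g) * (lieD (Z l) f).comp g := by
  ext x
  -- `X` need not be projectable. Only the image of `X x` matters at the point `x`, and it is
  -- extended to a field on `M'` chosen for this point.
  obtain ⟨X', hX'⟩ := exists_vf_apply_eq (g x) (mfderiv 𝓘(ℝ, EM) 𝓘(ℝ, EM') g x (X x))
  have h : χ * lieD X' f = ∑ l, lieD X' (c l) * lieD (Z l) f := by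
    rw [← lieD_smul_left, hc]
    simp only [← lieD_smul_left]
    exact map_sum (lieDHom f) _ _
  have h' := DFunLike.congr_fun h (g x)
  have e1 : ∀ f : Fn EM' M', lieD X (f.comp g) x = lieD X' f (g x) := fun f ↦ by
    rw [lieD_comp, lieD_apply, hX']
  rw [fn_sum_apply] at h' ⊢
  simpa only [ContMDiffMap.coe_mul, Pi.mul_apply, e1, ContMDiffMap.comp_apply] using h'

/-- The pullback connection on pulled back sections, in coordinates. -/
theorem FrameAtlas.smul_pullback_op_pull [SigmaCompactSpace M'] {ι : Type*}
    (A : FrameAtlas EM' F' V' ι) {χ : Fn EM' M'} {n : ℕ} {c : Fin n → Fn EM' M'}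
    {Z : Fin n → VF EM' M'} (hc : ∀ X : VF EM' M', χ • X = ∑ l, lieD X (c l) • Z l)
    (X : VF EM M) (s : Sec EM' F' V') :
    χ.comp g • (A.pullback g).connection.op X (pull g s) =
      ∑ l, lieD X ((c l).comp g) • pull g (A.connection.op (Z l) s) := by
  simp only [connection_op, ← pullback_glue]
  simp only [← map_smul, ← map_sum]
  congr 1
  funext i
  rw [Finset.sum_apply]
  simp only [Pi.smul_apply, pull_sum, pull_smul, Finset.smul_sum, smul_smul]
  rw [Finset.sum_comm]
  refine Finset.sum_congr rfl fun a _ ↦ ?_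
  rw [← Finset.sum_smul, ← lieD_comp_eq_sum g hc]
  rfl

theorem smul_op_of_lieD_eq_zero (N : LinearConnection EM F V) {Y : VF EM M} {f : Fn EM M}
    (hf : lieD Y f = 0) (s : Sec EM F V) : N.op Y (f • s) = f • N.op Y s := by
  rw [N.leibniz, hf, zero_smul, add_zero]

theorem linearConnection_op_sum (N : LinearConnection EM F V) (X : VF EM M) {κ : Type*}
    (t : Finset κ) (s : κ → Sec EM F V) : N.op X (∑ i ∈ t, s i) = ∑ i ∈ t, N.op X (s i) :=
  map_sum ({ toFun := N.op X, map_zero' := N.op_zero X, map_add' := N.add_right X } :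
    Sec EM F V →+ Sec EM F V) s t

theorem curv_sum (N : LinearConnection EM F V) [SigmaCompactSpace M] (X Y : VF EM M) {κ : Type*}
    (t : Finset κ) (s : κ → Sec EM F V) : N.curv X Y (∑ i ∈ t, s i) = ∑ i ∈ t, N.curv X Y (s i) := by
  simp only [LinearConnection.curv, linearConnection_op_sum, Finset.sum_sub_distrib]

/-- The pullback connection is flat in the directions of the fibres. -/
theorem FrameAtlas.pullback_curv_eq_zero [SigmaCompactSpace M] [SigmaCompactSpace M'] {ι : Type*}
    (A : FrameAtlas EM' F' V' ι) {Y : VF EM M}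
    (hY : ∀ x, mfderiv 𝓘(ℝ, EM) 𝓘(ℝ, EM') g x (Y x) = 0) (X : VF EM M)
    (w : Sec EM F' (g *ᵖ V')) : (A.pullback g).connection.curv Y X w = 0 := by
  have hY' : ∀ f : Fn EM' M', lieD Y (f.comp g) = 0 := lieD_comp_eq_zero g hY
  -- It is enough to treat pulled back sections, since the curvature is tensorial and the frames
  -- consist of such sections.
  have key : ∀ s : Sec EM' F' V', (A.pullback g).connection.curv Y X (pull g s) = 0 := by
    intro s
    ext x
    obtain ⟨χ, n, c, Z, hχ, hc⟩ := exists_coordinates (EM := EM') (g x)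
    -- The operator `∇_Y` kills pulled back sections and differentiates only the coefficients `X(c ∘
    -- g)`. The result cancels the bracket term because `[Y, X](c ∘ g) = Y(X(c ∘ g))`, as `Y(c ∘ g)
    -- = 0`.
    have h1 : χ.comp g • (A.pullback g).connection.curv Y X (pull g s) = 0 := by
      rw [LinearConnection.curv, A.pullback_op_pull_eq_zero g hY, LinearConnection.op_zero,
        sub_zero, smul_sub, ← smul_op_of_lieD_eq_zero _ (hY' χ), A.smul_pullback_op_pull g hc,
        A.smul_pullback_op_pull g hc, linearConnection_op_sum, sub_eq_zero]
      refine Finset.sum_congr rfl fun l _ ↦ ?_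
      rw [LinearConnection.leibniz, A.pullback_op_pull_eq_zero g hY, smul_zero, zero_add,
        lieD_bracket, hY']
      congr 1
      rw [eq_comm, sub_eq_self]
      exact lieD_zero_right X
    have h2 := congrArg (fun s : Sec EM F' (g *ᵖ V') ↦ s x) h1
    have h3 : χ (g x) • (A.pullback g).connection.curv Y X (pull g s) x = 0 := h2
    rwa [hχ.self_of_nhds, one_smul] at h3
  rw [← (A.pullback g).glue_smul ((A.pullback g).connection.curv Y X w)]
  have h : ∀ i, (A.pullback g).χ i • (A.pullback g).connection.curv Y X w = 0 := by
    intro i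
    rw [← LinearConnection.curv_smul_right, ← (A.pullback g).sum_coeff, curv_sum]
    refine Finset.sum_eq_zero fun a _ ↦ ?_
    rw [LinearConnection.curv_smul_right]
    exact (congrArg _ (key _)).trans (smul_zero _)
  simp only [h]
  exact map_zero _

end Pullback

/-! ### Right inverses of surjective bundle maps -/

section RightInverse

variable {EM : Type*} [NormedAddCommGroup EM] [NormedSpace ℝ EM] [FiniteDimensional ℝ EM]
  {M : Type*} [TopologicalSpace M] [ChartedSpace EM M] [IsManifold 𝓘(ℝ, EM) ∞ M] [T2Space M]
  [SigmaCompactSpace M]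
  {F : Type*} [NormedAddCommGroup F] [NormedSpace ℝ F]
  {V : M → Type*} [∀ x, AddCommGroup (V x)] [∀ x, Module ℝ (V x)]
  [∀ x, TopologicalSpace (V x)] [TopologicalSpace (TotalSpace F V)] [FiberBundle F V]
  [VectorBundle ℝ F V] [ContMDiffVectorBundle ∞ F V 𝓘(ℝ, EM)]
  {F' : Type*} [NormedAddCommGroup F'] [NormedSpace ℝ F'] [FiniteDimensional ℝ F']
  {W : M → Type*} [∀ x, AddCommGroup (W x)] [∀ x, Module ℝ (W x)]
  [∀ x, TopologicalSpace (W x)] [TopologicalSpace (TotalSpace F' W)] [FiberBundle F' W]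
  [VectorBundle ℝ F' W] [ContMDiffVectorBundle ∞ F' W 𝓘(ℝ, EM)]

theorem map_glue_eq {ι : Type*} (ρ : ι → Fn EM M)
    (hρ : LocallyFinite fun i ↦ Function.support (ρ i)) (L : ∀ x, V x →ₗ[ℝ] W x)
    (Φ : Sec EM F V →ₗ[Fn EM M] Sec EM F' W) (hΦ : ∀ e x, Φ e x = L x (e x))
    (T : ι → Sec EM F V) : Φ (glue ρ hρ T) = glue ρ hρ fun i ↦ Φ (T i) := by
  ext x
  rw [hΦ, glue_apply, glue_apply, map_finsum]
  · simp only [map_smul, hΦ]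
  · exact (hρ.point_finite x).subset fun i hi ↦ left_ne_zero_of_smul hi

/-- A surjective map of vector bundles has a right inverse. -/
theorem exists_rightInverse (L : ∀ x, V x →ₗ[ℝ] W x)
    (Φ : Sec EM F V →ₗ[Fn EM M] Sec EM F' W) (hΦ : ∀ e x, Φ e x = L x (e x))
    (hL : ∀ x, Function.Surjective (L x)) :
    ∃ Λ : Sec EM F' W →ₗ[Fn EM M] Sec EM F V, ∀ w, Φ (Λ w) = w := by
  -- Local frames of `W` are chosen among images of sections of `V`. Sending `Φ (e a)` to `e a` is
  -- then a local right inverse, and right inverses can be averaged with a partition of unity.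
  have H : ∀ x : M, ∃ (n : ℕ) (e : Fin n → Sec EM F V) (U : Set M), IsOpen U ∧ x ∈ U ∧
      IsLocalFrameOn 𝓘(ℝ, EM) F' ∞ (fun i y ↦ Φ (e i) y) U := by
    intro x
    have : FiniteDimensional ℝ (W x) := finiteDimensional_fiber (F := F') x
    let b := Module.finBasis ℝ (W x)
    choose v hv using fun i ↦ hL x (b i)
    choose S hS using fun i ↦ exists_sec_apply_eq (EM := EM) (F := F) (V := V) x (v i)
    have hb : (fun i ↦ Φ (S i) x) = b := funext fun i ↦ by rw [hΦ, hS, hv]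
    exact ⟨_, S, exists_isLocalFrameOn (by rw [hb]; exact b.linearIndependent)
      (by rw [hb]; exact b.span_eq.ge)⟩
  choose n e U hU hx he using H
  obtain ⟨χ, ρ, h1, h2, h3, h4⟩ := exists_partition (EM := EM) U fun x ↦ (hU x).mem_nhds (hx x)
  let A : FrameAtlas EM F' W M := ⟨n, fun i a ↦ Φ (e i a), U, hU, he, χ, ρ, h1, h2, h3, h4⟩
  refine ⟨glue ρ h3 ∘ₗ LinearMap.pi fun i ↦
    ∑ a, (LinearMap.toSpanSingleton (Fn EM M) _ (e i a)) ∘ₗ A.coeff i a, fun w ↦ ?_⟩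
  rw [LinearMap.comp_apply, map_glue_eq ρ h3 L Φ hΦ]
  refine Eq.trans ?_ (A.glue_smul w)
  change _ = glue ρ h3 _
  congr 1
  funext i
  rw [← A.sum_coeff]
  simp only [LinearMap.pi_apply, LinearMap.sum_apply, LinearMap.comp_apply,
    LinearMap.toSpanSingleton_apply, map_sum, map_smul]
  rfl

end RightInverse

/-! ### Frames adapted to subbundles -/

section Adapted

variable {EM : Type*} [NormedAddCommGroup EM] [NormedSpace ℝ EM] [FiniteDimensional ℝ EM]
  {M : Type*} [TopologicalSpace M] [ChartedSpace EM M] [IsManifold 𝓘(ℝ, EM) ∞ M] [T2Space M]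
  {F : Type*} [NormedAddCommGroup F] [NormedSpace ℝ F] [FiniteDimensional ℝ F]
  {V : M → Type*} [∀ x, AddCommGroup (V x)] [∀ x, Module ℝ (V x)]
  [∀ x, TopologicalSpace (V x)] [TopologicalSpace (TotalSpace F V)] [FiberBundle F V]
  [VectorBundle ℝ F V] [ContMDiffVectorBundle ∞ F V 𝓘(ℝ, EM)]
  (K : Subbundle EM F V)

/-- A local frame of `K`, extended by cut-offs, is completed by sections through lifts of a basis of
the quotient fibre at `x`. Being a basis at `x` suffices, by `exists_isLocalFrameOn`. -/
theorem Subbundle.exists_adapted_frame (x : M) :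
    ∃ (k m : ℕ) (b : Fin k → Sec EM F V) (c : Fin m → Sec EM F V) (U : Set M), IsOpen U ∧ x ∈ U ∧
      (∀ i, b i ∈ K.sections) ∧
      IsLocalFrameOn 𝓘(ℝ, EM) F ∞ (fun i y ↦ Sum.elim b c i y) U ∧
      ∀ y ∈ U, Submodule.span ℝ (range fun i ↦ b i y) = K.fiber y := by
  obtain ⟨U, hU, hxU, k, b, hb, hbK⟩ := K.locally_framed x
  choose B hB0 hBr hB using fun i ↦ exists_sec_eventuallyEq hU hxU (hb i)
  obtain ⟨U₁, hU₁, hU₁o, hxU₁⟩ := eventually_nhds_iff.1 (eventually_all.2 hB)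
  have : FiniteDimensional ℝ (V x) := finiteDimensional_fiber (F := F) x
  let q := Module.finBasis ℝ (V x ⧸ K.fiber x)
  choose v hv using fun j ↦ (K.fiber x).mkQ_surjective (q j)
  choose C hC using fun j ↦ exists_sec_apply_eq (EM := EM) (F := F) (V := V) x (v j)
  have hBK : ∀ i, B i ∈ K.sections := by
    intro i y
    by_cases hy : y ∈ U
    · obtain ⟨r, hr⟩ := hBr i y
      rw [hr, ← (hbK y hy).2]
      exact Submodule.smul_mem _ _ (Submodule.subset_span ⟨i, rfl⟩)
    · rw [hB0 i y hy]
      exact zero_mem _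
  have hspan : ∀ y ∈ U ∩ U₁, Submodule.span ℝ (range fun i ↦ B i y) = K.fiber y := by
    intro y hy
    rw [← (hbK y hy.1).2]
    simp only [hU₁ y hy.2]
  have hxs := hspan x ⟨hxU, hxU₁⟩
  have hq : (fun j ↦ (K.fiber x).mkQ (C j x)) = q := funext fun j ↦ by rw [hC, hv]
  have hli : LinearIndependent ℝ fun i ↦ Sum.elim B C i x := by
    have h1 : LinearIndependent ℝ fun i ↦ (⟨B i x, hBK i x⟩ : K.fiber x) := by
      have := (hbK x hxU).1
      simp only [← hU₁ x hxU₁] at this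
      exact LinearIndependent.of_comp (K.fiber x).subtype this
    have h2 : LinearIndependent ℝ fun j ↦ (K.fiber x).mkQ (C j x) := by
      rw [hq]; exact q.linearIndependent
    have := LinearIndependent.sumElim_of_quotient h1 _ h2
    have he : (fun i ↦ Sum.elim B C i x) =
        Sum.elim (fun i ↦ ((⟨B i x, hBK i x⟩ : K.fiber x) : V x)) fun j ↦ C j x := by
      funext i
      cases i <;> rfl
    rw [he]
    exact this
  have hsp : ⊤ ≤ Submodule.span ℝ (range fun i ↦ Sum.elim B C i x) := by
    intro w _
    have hw : w - ∑ j, q.repr ((K.fiber x).mkQ w) j • C j x ∈ K.fiber x := by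
      rw [← Submodule.Quotient.mk_eq_zero, ← Submodule.mkQ_apply, map_sub, map_sum]
      simp only [map_smul]
      have := q.sum_repr ((K.fiber x).mkQ w)
      simp only [← hq] at this
      rw [this, sub_self]
    rw [← sub_add_cancel w (∑ j, q.repr ((K.fiber x).mkQ w) j • C j x)]
    refine add_mem ?_ (Submodule.sum_mem _ fun j _ ↦ Submodule.smul_mem _ _
      (Submodule.subset_span ⟨Sum.inr j, rfl⟩))
    refine Submodule.span_mono ?_ (hxs.ge hw)
    rintro _ ⟨i, rfl⟩
    exact ⟨Sum.inl i, rfl⟩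
  obtain ⟨U₂, hU₂o, hxU₂, hfr⟩ := exists_isLocalFrameOn (e := Sum.elim B C) hli hsp
  exact ⟨k, _, B, C, U ∩ U₁ ∩ U₂, (hU.inter hU₁o).inter hU₂o, ⟨⟨hxU, hxU₁⟩, hxU₂⟩, hBK,
    hfr.mono inter_subset_right, fun y hy ↦ hspan y hy.1⟩

variable {K} in
theorem coeff_inr_eq_zero {k m : ℕ} {b : Fin k → Sec EM F V} {c : Fin m → Sec EM F V} {U : Set M}
    (h : IsLocalFrameOn 𝓘(ℝ, EM) F ∞ (fun i y ↦ Sum.elim b c i y) U)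
    (hK : ∀ y ∈ U, Submodule.span ℝ (range fun i ↦ b i y) = K.fiber y) (j : Fin m) (y : M) {v : V y}
    (hv : v ∈ K.fiber y) : h.coeff (Sum.inr j) y v = 0 := by
  by_cases hy : y ∈ U
  · rw [← hK y hy] at hv
    refine (Submodule.span_le (p := LinearMap.ker (h.coeff (Sum.inr j) y))).2 ?_ hv
    rintro _ ⟨i, rfl⟩
    have h1 : h.coeff (Sum.inr j) y (b i y) = (h.toBasisAt hy).repr (b i y) (Sum.inr j) := by
      simp [IsLocalFrameOn.coeff, hy]
    have h2 : b i y = h.toBasisAt hy (Sum.inl i) := by simp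
    change h.coeff (Sum.inr j) y (b i y) = 0
    rw [h1, h2, Module.Basis.repr_self, Finsupp.single_apply, if_neg (by simp)]
  -- Outside `U` the coefficient functionals are zero by convention.
  · simp [hy]

/-- A local frame of `V/K` with its coefficient functionals, cut off away from a point. -/
theorem Subbundle.exists_quot_frame [SigmaCompactSpace M] (x : M) :
    ∃ (χ : Fn EM M) (m : ℕ) (s : Fin m → K.QSec)
      (l : Fin m → ∀ y, (V y ⧸ K.fiber y) →ₗ[ℝ] ℝ), (∀ᶠ y in 𝓝 x, χ y = 1) ∧
      (∀ j (t : K.QSec), ContMDiff 𝓘(ℝ, EM) 𝓘(ℝ, ℝ) ∞ fun y ↦ l j y (t y)) ∧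
      (∀ y q, ∑ j, l j y q • s j y = χ y • q) ∧
      ∀ i j y, l j y (s i y) = if i = j then χ y else 0 := by
  obtain ⟨k, m, b, c, U, hU, hxU, hb, h, hK⟩ := K.exists_adapted_frame x
  obtain ⟨χ, hχ, hχ1⟩ := exists_cutoff (EM := EM) (hU.mem_nhds hxU)
  -- The coefficients along the complementary sections vanish on `K`, so they descend to `V/K`. The
  -- cut-off sits in `l` and not in the sections, so it enters each identity once.
  let l : Fin m → ∀ y, (V y ⧸ K.fiber y) →ₗ[ℝ] ℝ := fun j y ↦
    (K.fiber y).liftQ (χ y • h.coeff (Sum.inr j) y) fun v hv ↦ by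
      rw [LinearMap.mem_ker, LinearMap.smul_apply, coeff_inr_eq_zero h hK j y hv, smul_zero]
  have hl : ∀ j y v, l j y ((K.fiber y).mkQ v) = χ y * h.coeff (Sum.inr j) y v :=
    fun j y v ↦ rfl
  refine ⟨χ, m, fun j ↦ K.proj (c j), l, hχ1, fun j t ↦ ?_, fun y q ↦ ?_, fun i j y ↦ ?_⟩
  · obtain ⟨e, rfl⟩ := K.proj_surjective t
    exact (frameCoeff h hU χ hχ (Sum.inr j) e).contMDiff
  · obtain ⟨v, rfl⟩ := (K.fiber y).mkQ_surjective q
    by_cases hy : y ∈ U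
    · obtain ⟨S, rfl⟩ := exists_sec_apply_eq (EM := EM) (F := F) (V := V) y v
      have h1 := h.coeff_sum_eq (fun y ↦ S y) hy
      rw [Fintype.sum_sum_type] at h1
      have h2 := congrArg (K.fiber y).mkQ h1
      have h3 : ∀ i, (K.fiber y).mkQ (b i y) = 0 := fun i ↦
        (Submodule.Quotient.mk_eq_zero _).2 (hb i y)
      simp only [map_add, map_sum, map_smul, Sum.elim_inl, Sum.elim_inr, h3, smul_zero,
        Finset.sum_const_zero, zero_add] at h2
      simp only [hl, mul_smul, ← Finset.smul_sum, Subbundle.proj_apply]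
      exact congrArg (χ y • ·) h2.symm
    · have : χ y = 0 := image_eq_zero_of_notMem_tsupport fun h ↦ hy (hχ h)
      simp only [hl, this, zero_mul, zero_smul, Finset.sum_const_zero]
  · rw [Subbundle.proj_apply, hl]
    by_cases hy : y ∈ U
    · have h1 : h.coeff (Sum.inr j) y (c i y) = (h.toBasisAt hy).repr (c i y) (Sum.inr j) := by
        simp [IsLocalFrameOn.coeff, hy]
      have h2 : c i y = h.toBasisAt hy (Sum.inr i) := by simp
      rw [h1, h2, Module.Basis.repr_self, Finsupp.single_apply]
      simp
    · have : χ y = 0 := image_eq_zero_of_notMem_tsupport fun h ↦ hy (hχ h)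
      simp [this]

end Adapted

/-! ### Partial connections in coordinates -/

section PartialCoordinates

variable {EM : Type*} [NormedAddCommGroup EM] [NormedSpace ℝ EM] [FiniteDimensional ℝ EM]
  {M : Type*} [TopologicalSpace M] [ChartedSpace EM M] [IsManifold 𝓘(ℝ, EM) ∞ M] [T2Space M]
  [SigmaCompactSpace M]
  {F : Type*} [NormedAddCommGroup F] [NormedSpace ℝ F] [FiniteDimensional ℝ F]
  {V : M → Type*} [∀ x, AddCommGroup (V x)] [∀ x, Module ℝ (V x)]
  [∀ x, TopologicalSpace (V x)] [TopologicalSpace (TotalSpace F V)] [FiberBundle F V]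
  [VectorBundle ℝ F V] [ContMDiffVectorBundle ∞ F V 𝓘(ℝ, EM)]
  {D : InvolutiveSubbundle EM M} {K : Subbundle EM F V} (P : PartialConnection D K)

/-- The inclusion `Γ(K) → Γ(V)`. -/
def Subbundle.ssecVal (K : Subbundle EM F V) : K.SSec →ₗ[Fn EM M] Sec EM F V :=
  K.sections.subtype

/-- A partial connection as a linear map in the direction. -/
def PartialConnection.opHom (s : K.QSec) : D.SSec →ₗ[Fn EM M] K.QSec where
  toFun Y := P.op Y s
  map_add' Y Z := P.add_left Y Z s
  map_smul' f Y := P.smul_left f Y s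

/-- Here `Y` enters only through the derivatives `Y(cₗ)`, which along a curve depend on its velocity
alone. This makes the connection coefficients along a curve independent of the field `Y` in
`IsParallelAt`, which may change with time. -/
theorem PartialConnection.exists_coordinates (x : M) :
    ∃ (χ : Fn EM M) (n : ℕ) (c : Fin n → Fn EM M) (E : Fin n → K.QSec → K.QSec),
      (∀ᶠ y in 𝓝 x, χ y = 1) ∧
      ∀ (Y : D.SSec) (s : K.QSec), χ • P.op Y s = ∑ l, lieD Y.1 (c l) • E l s := by
  obtain ⟨χ₁, n, c, Z, hχ₁, hc⟩ := VBAtiyah.exists_coordinates (EM := EM) x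
  obtain ⟨k, m, b, b', U, hU, hxU, hb, h, hD⟩ := D.exists_adapted_frame x
  obtain ⟨χ₂, hχ₂, hχ₂1⟩ := exists_cutoff (EM := EM) (hU.mem_nhds hxU)
  refine ⟨χ₁ * χ₂, n, c, fun l s ↦ ∑ a, frameCoeff h hU χ₂ hχ₂ (Sum.inl a) (Z l) •
    P.op ⟨b a, hb a⟩ s, ?_, fun Y s ↦ ?_⟩
  · filter_upwards [hχ₁, hχ₂1] with y h1 h2
    change χ₁ y * χ₂ y = 1
    rw [h1, h2, one_mul]
  let bD : Fin k → D.SSec := fun a ↦ ⟨b a, hb a⟩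
  let f : Fin k → VF EM M →ₗ[Fn EM M] Fn EM M := fun a ↦ frameCoeff h hU χ₂ hχ₂ (Sum.inl a)
  -- The coordinate fields `Z l` need not lie in `D`, so only their components along the frame of
  -- `D` are kept. Nothing is lost, since `Y` has no other components.
  have key : (χ₁ * χ₂) • Y = ∑ l, lieD Y.1 (c l) • ∑ a, f a (Z l) • bD a := by
    have hinj : Function.Injective D.ssecVal := Subtype.val_injective
    refine hinj ?_
    have h1 := sum_frameCoeff (e := Sum.elim b b') h hU χ₂ hχ₂ (χ₁ • Y.1)
    have h2 : ∀ j, frameCoeff h hU χ₂ hχ₂ (Sum.inr j) (χ₁ • Y.1) = 0 := by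
      intro j
      ext y
      rw [frameCoeff_apply, coeff_inr_eq_zero h hD j y (D.sections.smul_mem χ₁ Y.2 y), mul_zero]
      rfl
    have h3 : ∀ a, f a (χ₁ • Y.1) = ∑ l, lieD Y.1 (c l) * f a (Z l) := by
      intro a
      rw [hc, map_sum]
      simp only [map_smul, smul_eq_mul]
    have h4 : ∑ a, f a (χ₁ • Y.1) • b a = χ₂ • χ₁ • Y.1 := by
      rw [← h1, Fintype.sum_sum_type, Finset.sum_eq_zero (s := Finset.univ (α := Fin m)), add_zero]
      · rfl
      · intro j _
        rw [h2, zero_smul]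
    rw [map_smul, map_sum]
    simp only [map_sum, map_smul]
    change (χ₁ * χ₂) • Y.1 = ∑ l, lieD Y.1 (c l) • ∑ a, f a (Z l) • b a
    rw [mul_comm, mul_smul, ← h4]
    simp only [h3, Finset.sum_smul, Finset.smul_sum, mul_smul]
    exact Finset.sum_comm
  change (χ₁ * χ₂) • P.opHom s Y = _
  rw [← map_smul, key, map_sum]
  simp only [map_sum, map_smul]
  rfl

end PartialCoordinates

/-! ### Uniqueness of parallel transport -/

section Uniqueness

/-- A curve with `‖a'‖ ≤ C ‖a‖` that vanishes at some time vanishes identically. -/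
theorem eq_zero_of_norm_deriv_le {G : Type*} [NormedAddCommGroup G] [NormedSpace ℝ G]
    {a a' : ℝ → G} {J : Set ℝ} (hJ : J.OrdConnected) {C : ℝ} (ha : ∀ t ∈ J, HasDerivAt a (a' t) t)
    (hC : ∀ t ∈ J, ‖a' t‖ ≤ C * ‖a t‖) {t₁ t₂ : ℝ} (h₁ : t₁ ∈ J) (h₂ : t₂ ∈ J) (h0 : a t₁ = 0) :
    a t₂ = 0 := by
  rcases le_total t₁ t₂ with h | h
  · have hs : Icc t₁ t₂ ⊆ J := hJ.out h₁ h₂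
    exact eq_zero_of_abs_deriv_le_mul_abs_self_of_eq_zero_right (f := a) (f' := a') (K := C)
      (fun t ht ↦ (ha t (hs ht)).continuousAt.continuousWithinAt)
      (fun t ht ↦ (ha t (hs (Ico_subset_Icc_self ht))).hasDerivWithinAt) h0
      (fun t ht ↦ hC t (hs (Ico_subset_Icc_self ht))) t₂ ⟨h, le_rfl⟩
  -- Backward in time, the estimate is applied to the reflected curve `t ↦ a (-t)`.
  · have hs : ∀ t ∈ Icc (-t₁) (-t₂), -t ∈ J := fun t ht ↦
      hJ.out h₂ h₁ ⟨by linarith [ht.2], by linarith [ht.1]⟩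
    have hd : ∀ t ∈ Icc (-t₁) (-t₂), HasDerivAt (fun t ↦ a (-t)) (-a' (-t)) t := fun t ht ↦ by
      have h := (ha (-t) (hs t ht)).scomp t (hasDerivAt_neg t)
      rw [neg_smul, one_smul] at h
      exact h
    have := eq_zero_of_abs_deriv_le_mul_abs_self_of_eq_zero_right (f := fun t ↦ a (-t))
      (f' := fun t ↦ -a' (-t)) (K := C) (a := -t₁) (b := -t₂)
      (fun t ht ↦ (hd t ht).continuousAt.continuousWithinAt)
      (fun t ht ↦ (hd t (Ico_subset_Icc_self ht)).hasDerivWithinAt) (by simpa using h0)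
      (fun t ht ↦ by rw [norm_neg]; exact hC _ (hs t (Ico_subset_Icc_self ht)))
      (-t₂) ⟨by linarith, le_rfl⟩
    simpa using this

variable {EM : Type*} [NormedAddCommGroup EM] [NormedSpace ℝ EM] [FiniteDimensional ℝ EM]
  {M : Type*} [TopologicalSpace M] [ChartedSpace EM M] [IsManifold 𝓘(ℝ, EM) ∞ M] [T2Space M]
  [SigmaCompactSpace M]
  {F : Type*} [NormedAddCommGroup F] [NormedSpace ℝ F] [FiniteDimensional ℝ F]
  {V : M → Type*} [∀ x, AddCommGroup (V x)] [∀ x, Module ℝ (V x)]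
  [∀ x, TopologicalSpace (V x)] [TopologicalSpace (TotalSpace F V)] [FiberBundle F V]
  [VectorBundle ℝ F V] [ContMDiffVectorBundle ∞ F V 𝓘(ℝ, EM)]
  {D : InvolutiveSubbundle EM M} {K : Subbundle EM F V} (P : PartialConnection D K)

theorem qsec_sum_apply {κ : Type*} (t : Finset κ) (s : κ → K.QSec) (y : M) :
    (∑ i ∈ t, s i) y = ∑ i ∈ t, s i y :=
  map_sum ({ toFun := fun s ↦ s y, map_zero' := rfl, map_add' := fun _ _ ↦ rfl } :
    K.QSec →+ V y ⧸ K.fiber y) s t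

theorem PartialConnection.op_sum (Y : D.SSec) {κ : Type*} (t : Finset κ) (s : κ → K.QSec) :
    P.op Y (∑ i ∈ t, s i) = ∑ i ∈ t, P.op Y (s i) :=
  map_sum ({ toFun := P.op Y, map_zero' := P.op_zero Y, map_add' := P.add_right Y } :
    K.QSec →+ K.QSec) s t

theorem hasDerivAt_comp_curve {c : ℝ → M} {t : ℝ} (hc : MDifferentiableAt 𝓘(ℝ, ℝ) 𝓘(ℝ, EM) c t)
    {Y : VF EM M} (hY : Y (c t) = mfderiv 𝓘(ℝ, ℝ) 𝓘(ℝ, EM) c t (1 : ℝ)) (f : Fn EM M) :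
    HasDerivAt (fun τ ↦ f (c τ)) (lieD Y f (c t)) t := by
  have hf := f.contMDiff.mdifferentiable (by simp) (c t)
  have h1 : HasMFDerivAt 𝓘(ℝ, ℝ) 𝓘(ℝ, ℝ) (f ∘ c) t _ := hf.hasMFDerivAt.comp t hc.hasMFDerivAt
  refine (mdifferentiableAt_iff_differentiableAt.1 h1.mdifferentiableAt).hasDerivAt.congr_deriv ?_
  rw [← fderiv_apply_one_eq_deriv, ← mfderiv_eq_fderiv, h1.mfderiv, lieD_apply, hY]
  rfl

theorem lieD_eq_zero_of_eventually_eq {f : Fn EM M} {y : M} {r : ℝ} (h : ∀ᶠ z in 𝓝 y, f z = r)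
    (X : VF EM M) : lieD X f y = 0 := by
  have h1 : (f : M → ℝ) =ᶠ[𝓝 y] fun _ ↦ r := h
  have h2 := h1.mfderiv_eq (I := 𝓘(ℝ, EM)) (I' := 𝓘(ℝ, ℝ))
  rw [mfderiv_const] at h2
  exact DFunLike.congr_fun h2 (X y)

/-- The coordinates of a parallel section satisfy a linear differential equation. -/
theorem PartialConnection.IsParallelAt.hasDerivAt {c : ℝ → M} {u : ∀ t, V (c t) ⧸ K.fiber (c t)}
    {t : ℝ} (hu : P.IsParallelAt c u t) (hc : ContMDiffAt 𝓘(ℝ, ℝ) 𝓘(ℝ, EM) ∞ c t)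
    {χ : Fn EM M} {m : ℕ} {s : Fin m → K.QSec} {l : Fin m → ∀ y, (V y ⧸ K.fiber y) →ₗ[ℝ] ℝ}
    (hχ : ∀ᶠ y in 𝓝 (c t), χ y = 1)
    (hl : ∀ j (t : K.QSec), ContMDiff 𝓘(ℝ, EM) 𝓘(ℝ, ℝ) ∞ fun y ↦ l j y (t y))
    (hls : ∀ y q, ∑ j, l j y q • s j y = χ y • q)
    (hlδ : ∀ i j y, l j y (s i y) = if i = j then χ y else 0) :
    ∃ Y : D.SSec, Y.1 (c t) = mfderiv 𝓘(ℝ, ℝ) 𝓘(ℝ, EM) c t (1 : ℝ) ∧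
      ∀ j, HasDerivAt (fun τ ↦ l j (c τ) (u τ))
        (-∑ k, l k (c t) (u t) * l j (c t) (P.op Y (s k) (c t))) t := by
  obtain ⟨n, f, r, Y, hf, hu1, hY, hu2⟩ := hu
  refine ⟨Y, hY, fun j ↦ ?_⟩
  let G : Fin n → Fin m → Fn EM M := fun i j ↦ ⟨_, hl j (r i)⟩
  have hG : ∀ i j y, G i j y = l j y (r i y) := fun _ _ _ ↦ rfl
  have h1 : HasDerivAt (fun τ ↦ ∑ i, f i τ * G i j (c τ))
      (∑ i, (deriv (f i) t * G i j (c t) + f i t * lieD Y.1 (G i j) (c t))) t :=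
    HasDerivAt.fun_sum fun i _ ↦ (hf i).hasDerivAt.mul (hasDerivAt_comp_curve (hc.mdifferentiableAt (by simp)) hY (G i j))
  have h2 : (fun τ ↦ l j (c τ) (u τ)) =ᶠ[𝓝 t] fun τ ↦ ∑ i, f i τ * G i j (c τ) := by
    filter_upwards [hu1] with τ hτ
    rw [hτ, map_sum]
    simp only [map_smul, smul_eq_mul, hG]
  refine (h1.congr_of_eventuallyEq h2).congr_deriv ?_
  -- The sections `r i` of the parallelism condition are rewritten in the fixed frame. The cut-off
  -- contributes no derivative, because it is `1` near `c t`.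
  have h3 : ∀ i, P.op Y (r i) (c t) = ∑ k, (G i k (c t) • P.op Y (s k) (c t) +
      lieD Y.1 (G i k) (c t) • s k (c t)) := by
    intro i
    have h4 : χ • r i = ∑ k, G i k • s k := by
      apply Subbundle.QSec.ext
      intro y
      rw [qsec_sum_apply]
      exact (hls y (r i y)).symm
    have h5 := congrArg (fun q : K.QSec ↦ q (c t)) (congrArg (P.op Y) h4)
    simp only [P.leibniz, P.op_sum, qsec_sum_apply, Subbundle.quot_add_apply,
      Subbundle.quot_smul_apply, hχ.self_of_nhds, lieD_eq_zero_of_eventually_eq hχ, one_smul,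
      zero_smul, add_zero] at h5
    exact h5
  have h6 := congrArg (l j (c t)) hu2
  simp only [map_sum, map_add, map_smul, smul_eq_mul, map_zero, h3, ← hG, hlδ,
    hχ.self_of_nhds, mul_ite, mul_one, mul_zero, Finset.sum_add_distrib, mul_add,
    Finset.sum_ite_eq', Finset.mem_univ, if_true] at h6
  have h7 : ∀ k, l k (c t) (u t) = ∑ i, f i t * G i k (c t) := fun k ↦ by
    rw [hu1.self_of_nhds, map_sum]
    simp only [map_smul, smul_eq_mul, hG]
  simp only [h7, Finset.sum_mul, Finset.sum_add_distrib]
  rw [Finset.sum_comm]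
  simp only [Finset.mul_sum, mul_assoc] at h6 ⊢
  linarith

/-- In a frame of `V/K` the coordinates of `u` solve a linear equation with locally bounded
coefficients, so they vanish at both times or at neither. -/
theorem PartialConnection.eventually_eq_zero_iff {c : ℝ → M} {u : ∀ t, V (c t) ⧸ K.fiber (c t)}
    (h : ∀ t ∈ Icc (0 : ℝ) 1, ContMDiffAt 𝓘(ℝ, ℝ) 𝓘(ℝ, EM) ∞ c t ∧ P.IsParallelAt c u t)
    {t₀ : ℝ} (ht₀ : t₀ ∈ Icc (0 : ℝ) 1) :
    ∀ᶠ t in 𝓝[Icc 0 1] t₀, (u t₀ = 0 → u t = 0) ∧ (u t = 0 → u t₀ = 0) := by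
  obtain ⟨χ, m, s, l, hχ, hl, hls, hlδ⟩ := K.exists_quot_frame (c t₀)
  obtain ⟨χ', n, z, E, hχ', hE⟩ := P.exists_coordinates (c t₀)
  have hc0 := (h t₀ ht₀).1.continuousAt
  -- The coefficients are written with `deriv (z i ∘ c)` in place of `Y`. This makes them continuous
  -- in `t`, hence bounded near `t₀`.
  let Γ : Fin m → Fin m → ℝ → ℝ := fun j k t ↦
    ∑ i, deriv (fun τ ↦ z i (c τ)) t * l j (c t) (E i (s k) (c t))
  have hΓ : ∀ j k, ContinuousAt (Γ j k) t₀ := by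
    intro j k
    refine tendsto_finsetSum _ fun i _ ↦ ?_
    have h1 : ContDiffAt ℝ ∞ (fun τ ↦ z i (c τ)) t₀ :=
      ((z i).contMDiff.contMDiffAt.comp t₀ (h t₀ ht₀).1).contDiffAt
    have h2 : ContinuousAt (deriv fun τ ↦ z i (c τ)) t₀ :=
      ((h1.fderiv_right (m := 0) (by simp)).continuousAt.clm_apply continuousAt_const :
        ContinuousAt (fun t ↦ fderiv ℝ (fun τ ↦ z i (c τ)) t 1) t₀)
    exact h2.mul ((hl j (E i (s k))).continuous.continuousAt.comp hc0)
  have hB : ∀ᶠ t in 𝓝 t₀, ∀ j k, |Γ j k t| ≤ |Γ j k t₀| + 1 := by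
    refine eventually_all.2 fun j ↦ eventually_all.2 fun k ↦ ?_
    have := (hΓ j k).abs.eventually (gt_mem_nhds (lt_add_one |Γ j k t₀|))
    filter_upwards [this] with t ht using ht.le
  have hN : ∀ᶠ t in 𝓝 t₀, (∀ᶠ y in 𝓝 (c t), χ y = 1) ∧ χ' (c t) = 1 ∧
      ∀ j k, |Γ j k t| ≤ |Γ j k t₀| + 1 := by
    filter_upwards [hc0.eventually hχ.eventually_nhds, hc0.eventually hχ', hB] with t h1 h2 h3
      using ⟨h1, h2, h3⟩
  obtain ⟨ε, hε, hN⟩ := Metric.eventually_nhds_iff_ball.1 hN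
  let J : Set ℝ := Metric.ball t₀ ε ∩ Icc 0 1
  have hJ : J.OrdConnected := by
    change (Metric.ball t₀ ε ∩ Icc 0 1).OrdConnected
    rw [Real.ball_eq_Ioo]
    exact ordConnected_Ioo.inter ordConnected_Icc
  let a : ℝ → Fin m → ℝ := fun t j ↦ l j (c t) (u t)
  let a' : ℝ → Fin m → ℝ := fun t j ↦ -∑ k, a t k * Γ j k t
  have ha : ∀ t ∈ J, HasDerivAt a (a' t) t := by
    intro t ht
    obtain ⟨h1, h2, -⟩ := hN t ht.1
    obtain ⟨Y, hY, hd⟩ := (h t ht.2).2.hasDerivAt (P := P) (h t ht.2).1 h1 hl hls hlδ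
    rw [hasDerivAt_pi]
    intro j
    refine (hd j).congr_deriv ?_
    change _ = -∑ k, _
    congr 1
    refine Finset.sum_congr rfl fun k _ ↦ ?_
    congr 1
    have h3 := congrArg (fun q : K.QSec ↦ l j (c t) (q (c t))) (hE Y (s k))
    simp only [qsec_sum_apply, Subbundle.quot_smul_apply, h2, one_smul, map_sum, map_smul,
      smul_eq_mul] at h3
    rw [h3]
    refine Finset.sum_congr rfl fun i _ ↦ ?_
    rw [(hasDerivAt_comp_curve ((h t ht.2).1.mdifferentiableAt (by simp)) hY (z i)).deriv]
  have hC : ∀ t ∈ J, ‖a' t‖ ≤ (∑ j, ∑ k, (|Γ j k t₀| + 1)) * ‖a t‖ := by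
    intro t ht
    have hpos : ∀ j k, 0 ≤ |Γ j k t₀| + 1 := fun j k ↦ by positivity
    rw [pi_norm_le_iff_of_nonneg (mul_nonneg
      (Finset.sum_nonneg fun j _ ↦ Finset.sum_nonneg fun k _ ↦ hpos j k) (norm_nonneg _))]
    intro j
    calc ‖a' t j‖ = ‖∑ k, a t k * Γ j k t‖ := norm_neg _
      _ ≤ ∑ k, ‖a t k * Γ j k t‖ := norm_sum_le _ _
      _ ≤ ∑ k, (|Γ j k t₀| + 1) * ‖a t‖ := by
        refine Finset.sum_le_sum fun k _ ↦ ?_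
        rw [norm_mul, mul_comm]
        exact mul_le_mul ((hN t ht.1).2.2 j k) (norm_le_pi_norm _ k) (norm_nonneg _) (hpos j k)
      _ = (∑ k, (|Γ j k t₀| + 1)) * ‖a t‖ := by rw [Finset.sum_mul]
      _ ≤ _ := by
        refine mul_le_mul_of_nonneg_right ?_ (norm_nonneg _)
        exact Finset.single_le_sum (f := fun j ↦ ∑ k, (|Γ j k t₀| + 1))
          (fun j _ ↦ Finset.sum_nonneg fun k _ ↦ hpos j k) (Finset.mem_univ j)
  have hua : ∀ t ∈ J, u t = 0 ↔ a t = 0 := by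
    intro t ht
    refine ⟨fun h ↦ funext fun j ↦ ?_, fun h ↦ ?_⟩
    · change l j (c t) (u t) = 0
      rw [h, map_zero]
    · have h1 := hls (c t) (u t)
      rw [(hN t ht.1).1.self_of_nhds, one_smul] at h1
      rw [← h1]
      refine Finset.sum_eq_zero fun j _ ↦ ?_
      rw [show l j (c t) (u t) = 0 from congrFun h j, zero_smul]
  have hJ0 : t₀ ∈ J := ⟨Metric.mem_ball_self hε, ht₀⟩
  filter_upwards [self_mem_nhdsWithin, mem_nhdsWithin_of_mem_nhds (Metric.ball_mem_nhds t₀ hε)]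
    with t h1 h2
  have htJ : t ∈ J := ⟨h2, h1⟩
  rw [hua t htJ, hua t₀ hJ0]
  exact ⟨eq_zero_of_norm_deriv_le hJ ha hC hJ0 htJ, eq_zero_of_norm_deriv_le hJ ha hC htJ hJ0⟩

/-- Parallel transport preserves vanishing. -/
theorem PartialConnection.TransportEquiv.eq_zero_iff {p q : Σ x : M, V x ⧸ K.fiber x}
    (h : P.TransportEquiv p q) : p.2 = 0 ↔ q.2 = 0 := by
  induction h with
  | rel p q h =>
    obtain ⟨c, u, h, rfl, rfl⟩ := h
    -- Vanishing is a locally constant property on `[0, 1]`, and the interval is connected.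
    have := fun {a b} (ha : a ∈ Icc (0 : ℝ) 1) (hb : b ∈ Icc (0 : ℝ) 1) ↦
      isPreconnected_Icc.induction₂' (fun t t' ↦ u t = 0 → u t' = 0)
      (fun t ht ↦ P.eventually_eq_zero_iff h ht) (fun _ _ _ _ _ _ h1 h2 h3 ↦ h2 (h1 h3)) ha hb
    exact ⟨this (left_mem_Icc.2 zero_le_one) (right_mem_Icc.2 zero_le_one),
      this (right_mem_Icc.2 zero_le_one) (left_mem_Icc.2 zero_le_one)⟩
  | refl => rfl
  | symm _ _ _ ih => exact ih.symm
  | trans _ _ _ _ _ ih ih' => exact ih.trans ih'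

end Uniqueness

/-! ### Existence of parallel transport -/

section Existence

variable {EM : Type*} [NormedAddCommGroup EM] [NormedSpace ℝ EM] [FiniteDimensional ℝ EM]
  {M : Type*} [TopologicalSpace M] [ChartedSpace EM M] [IsManifold 𝓘(ℝ, EM) ∞ M] [T2Space M]
  [SigmaCompactSpace M]

/-- Since `(f ∘ c)' = (Y f) ∘ c`, each derivative is again of the same form; the induction therefore
runs over all `f` at once. -/
theorem contDiffOn_comp_integralCurve {Y : VF EM M} {c : ℝ → M} {J : Set ℝ} (hJ : IsOpen J)
    (hc : ∀ t ∈ J, MDifferentiableAt 𝓘(ℝ, ℝ) 𝓘(ℝ, EM) c t ∧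
      Y (c t) = mfderiv 𝓘(ℝ, ℝ) 𝓘(ℝ, EM) c t (1 : ℝ)) (n : ℕ) (f : Fn EM M) :
    ContDiffOn ℝ n (fun t ↦ f (c t)) J := by
  induction n generalizing f with
  | zero =>
    exact contDiffOn_zero.2 fun t ht ↦
      (hasDerivAt_comp_curve (hc t ht).1 (hc t ht).2 f).continuousAt.continuousWithinAt
  | succ n ih =>
    push_cast
    rw [contDiffOn_succ_iff_deriv_of_isOpen hJ]
    refine ⟨fun t ht ↦ (hasDerivAt_comp_curve (hc t ht).1 (hc t ht).2
      f).differentiableAt.differentiableWithinAt, by simp, (ih (lieD Y f)).congr fun t ht ↦ ?_⟩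
    exact (hasDerivAt_comp_curve (hc t ht).1 (hc t ht).2 f).deriv

/-- The integral curves of a smooth vector field are smooth. -/
theorem exists_smooth_integralCurve (Y : VF EM M) (x : M) :
    ∃ c : ℝ → M, c 0 = x ∧ ∀ᶠ t in 𝓝 0, ContMDiffAt 𝓘(ℝ, ℝ) 𝓘(ℝ, EM) ∞ c t ∧
      Y (c t) = mfderiv 𝓘(ℝ, ℝ) 𝓘(ℝ, EM) c t (1 : ℝ) := by
  have : CompleteSpace EM := FiniteDimensional.complete ℝ EM
  have : IsManifold 𝓘(ℝ, EM) 1 M := IsManifold.of_le (n := ∞) (by simp)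
  obtain ⟨c, rfl, hc⟩ := exists_isMIntegralCurveAt_of_contMDiffAt_boundaryless (t₀ := 0)
    (v := fun y ↦ Y y) (x₀ := x) ((Y.contMDiff x).of_le (by simp))
  have hcc : ContinuousAt c 0 := hc.continuousAt
  have hcd : ∀ᶠ t in 𝓝 (0 : ℝ), MDifferentiableAt 𝓘(ℝ, ℝ) 𝓘(ℝ, EM) c t ∧
      Y (c t) = mfderiv 𝓘(ℝ, ℝ) 𝓘(ℝ, EM) c t (1 : ℝ) := by
    filter_upwards [hc] with t ht
    refine ⟨ht.mdifferentiableAt, ?_⟩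
    rw [ht.mfderiv]
    exact (one_smul ℝ (Y (c t))).symm
  obtain ⟨J, hJ, hJo, h0⟩ := eventually_nhds_iff.1 hcd
  obtain ⟨χ, hχ, hχ1⟩ := exists_cutoff (EM := EM) ((chartAt EM (c 0)).open_source.mem_nhds
    (mem_chart_source EM (c 0)))
  refine ⟨c, rfl, ?_⟩
  filter_upwards [hcc.eventually hχ1.eventually_nhds, hJo.mem_nhds h0, hcc.eventually (
    (chartAt EM (c 0)).open_source.mem_nhds (mem_chart_source EM (c 0)))] with t h1 h2 h3
  have hct := (hJ t h2).1.continuousAt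
  refine ⟨?_, (hJ t h2).2⟩
  rw [contMDiffAt_iff_target_of_mem_source h3]
  refine ⟨hct, ContDiffAt.contMDiffAt ?_⟩
  let b := Module.finBasis ℝ EM
  rw [← b.equivFunL.comp_contDiffAt_iff, contDiffAt_pi]
  intro i
  -- Smoothness of `c` is tested on chart coordinates, cut off to become global functions on `M`.
  let f : Fn EM M := ⟨_, exists_smul_eq_of_tsupport (chartAt EM (c 0)).open_source χ hχ
    (f := fun y ↦ b.equivFunL (extChartAt 𝓘(ℝ, EM) (c 0) y) i)
    (((ContinuousLinearMap.proj (R := ℝ) (φ := fun _ ↦ ℝ) i).comp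
      b.equivFunL.toContinuousLinearMap).contMDiff.comp_contMDiffOn (contMDiffOn_extChartAt))⟩
  have hf : ContDiffAt ℝ ∞ (fun t ↦ f (c t)) t :=
    (contDiffOn_infty.2 fun n ↦ contDiffOn_comp_integralCurve hJo hJ n f).contDiffAt
      (hJo.mem_nhds h2)
  refine hf.congr_of_eventuallyEq ?_
  filter_upwards [hct.eventually h1] with τ hτ
  change _ = χ (c τ) * _
  rw [hτ, one_mul]
  rfl

/-- Linear differential equations have solutions. -/
theorem exists_linear_ode {G : Type*} [NormedAddCommGroup G] [NormedSpace ℝ G] [CompleteSpace G]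
    {B : ℝ → G →L[ℝ] G} (hB : ContDiffAt ℝ 1 B 0) (a₀ : G) :
    ∃ a : ℝ → G, a 0 = a₀ ∧ ∀ᶠ t in 𝓝 0, HasDerivAt a (B t (a t)) t := by
  -- Adding time as a coordinate makes the equation autonomous.
  have hf : ContDiffAt ℝ 1 (fun p : ℝ × G ↦ ((1 : ℝ), B p.1 p.2)) (0, a₀) :=
    contDiffAt_const.prodMk
      ((ContDiffAt.comp (g := B) (f := Prod.fst) ((0 : ℝ), a₀) hB contDiffAt_fst).clm_apply
        contDiffAt_snd)
  obtain ⟨α, hα0, ε, hε, hα⟩ :=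
    hf.exists_forall_mem_closedBall_exists_eq_forall_mem_Ioo_hasDerivAt₀ 0
  have h0 : (0 : ℝ) ∈ Ioo (0 - ε) (0 + ε) := ⟨by linarith, by linarith⟩
  -- The time coordinate of the solution is `t`: the difference starts at `0` and has derivative
  -- `0`.
  have h1 : ∀ t ∈ Ioo (0 - ε) (0 + ε), (α t).1 - t = 0 := fun t ht ↦
    eq_zero_of_norm_deriv_le (a := fun t ↦ (α t).1 - t) (a' := fun _ ↦ 0) (C := 0)
      ordConnected_Ioo (fun t ht ↦ by
        have := (hasFDerivAt_fst.comp_hasDerivAt t (hα t ht)).fun_sub (hasDerivAt_id' t)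
        exact this.congr_deriv (sub_self 1)) (by simp) h0 ht (by simp [hα0])
  refine ⟨fun t ↦ (α t).2, by simp [hα0], ?_⟩
  filter_upwards [Ioo_mem_nhds h0.1 h0.2] with t ht
  have := hasFDerivAt_snd.comp_hasDerivAt t (hα t ht)
  exact this.congr_deriv (by simp [sub_eq_zero.1 (h1 t ht)])

variable {F : Type*} [NormedAddCommGroup F] [NormedSpace ℝ F] [FiniteDimensional ℝ F]
  {V : M → Type*} [∀ x, AddCommGroup (V x)] [∀ x, Module ℝ (V x)]
  [∀ x, TopologicalSpace (V x)] [TopologicalSpace (TotalSpace F V)] [FiberBundle F V]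
  [VectorBundle ℝ F V] [ContMDiffVectorBundle ∞ F V 𝓘(ℝ, EM)]
  {D : InvolutiveSubbundle EM M} {K : Subbundle EM F V} (P : PartialConnection D K)

/-- Parallel transport exists along the integral curves of sections of `D`, for short times. -/
theorem PartialConnection.exists_transport (Y : D.SSec) (x : M) {χ : Fn EM M} {m : ℕ}
    {s : Fin m → K.QSec} {l : Fin m → ∀ y, (V y ⧸ K.fiber y) →ₗ[ℝ] ℝ}
    (hχ : ∀ᶠ y in 𝓝 x, χ y = 1)
    (hl : ∀ j (t : K.QSec), ContMDiff 𝓘(ℝ, EM) 𝓘(ℝ, ℝ) ∞ fun y ↦ l j y (t y))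
    (hls : ∀ y q, ∑ j, l j y q • s j y = χ y • q) (a₀ : Fin m → ℝ) :
    ∃ (c : ℝ → M) (a : ℝ → Fin m → ℝ), c 0 = x ∧ a 0 = a₀ ∧
      MDifferentiableAt 𝓘(ℝ, ℝ) 𝓘(ℝ, EM) c 0 ∧
      Y.1 (c 0) = mfderiv 𝓘(ℝ, ℝ) 𝓘(ℝ, EM) c 0 (1 : ℝ) ∧
      (∀ j, HasDerivAt (fun t ↦ a t j) (-∑ k, a₀ k * l j x (P.op Y (s k) x)) 0) ∧
      ∀ᶠ τ in 𝓝 0, P.Transport ⟨c 0, ∑ j, a 0 j • s j (c 0)⟩ ⟨c τ, ∑ j, a τ j • s j (c τ)⟩ := by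
  obtain ⟨c, hc0, hc⟩ := exists_smooth_integralCurve Y.1 x
  have hcc := hc.self_of_nhds.1
  -- Minus the connection matrix of `P` along `c`.
  let B : ℝ → (Fin m → ℝ) →L[ℝ] (Fin m → ℝ) := fun t ↦
    -∑ j, ∑ k, l j (c t) (P.op Y (s k) (c t)) •
      (ContinuousLinearMap.proj (R := ℝ) (φ := fun _ : Fin m ↦ ℝ) k).smulRight (Pi.single j (1 : ℝ))
  have hBa : ∀ t a j, B t a j = -∑ k, a k * l j (c t) (P.op Y (s k) (c t)) := fun t a j ↦ by
    simp [B, mul_comm, Pi.single_apply]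
  have hB : ContDiffAt ℝ 1 B 0 := by
    refine ContDiffAt.neg (ContDiffAt.sum fun j _ ↦ ContDiffAt.sum fun k _ ↦
      ContDiffAt.fun_smul ?_ contDiffAt_const)
    exact (((hl j (P.op Y (s k))).contMDiffAt.comp (0 : ℝ) hcc).contDiffAt).of_le (by simp)
  obtain ⟨a, ha0, ha⟩ := exists_linear_ode hB a₀
  refine ⟨c, a, hc0, ha0, hcc.mdifferentiableAt (by simp), hc.self_of_nhds.2, fun j ↦ ?_, ?_⟩
  · have := hasDerivAt_pi.1 ha.self_of_nhds j
    rwa [hBa, ha0, hc0] at this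
  have hχc : ∀ᶠ t in 𝓝 (0 : ℝ), χ (c t) = 1 := hcc.continuousAt.eventually (hc0.symm ▸ hχ)
  obtain ⟨ε, hε, H⟩ := Metric.eventually_nhds_iff_ball.1 (hc.and (ha.and hχc))
  filter_upwards [Metric.ball_mem_nhds (0 : ℝ) hε] with τ hτ
  let q : ℝ → Σ y, V y ⧸ K.fiber y := fun t ↦ ⟨c t, ∑ j, a t j • s j (c t)⟩
  -- Transport is defined with paths on `[0, 1]`, so time is rescaled by `τ`, of either sign. The
  -- velocity is then given by `τ • Y`.
  refine ⟨fun t ↦ c (τ * t), fun t ↦ ∑ j, a (τ * t) j • s j (c (τ * t)), fun t ht ↦ ?_,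
    congrArg q (mul_zero τ).symm, congrArg q (mul_one τ).symm⟩
  have htJ : τ * t ∈ Metric.ball (0 : ℝ) ε := by
    rw [mem_ball_zero_iff, norm_mul] at *
    refine (mul_le_of_le_one_right (norm_nonneg _) ?_).trans_lt hτ
    rw [Real.norm_eq_abs, abs_le]
    exact ⟨by linarith [ht.1], ht.2⟩
  obtain ⟨⟨h1, h2⟩, h3, h4⟩ := H _ htJ
  have hm : HasDerivAt (fun t ↦ τ * t) τ t := by simpa using (hasDerivAt_id t).const_mul τ
  have hmm : ContMDiffAt 𝓘(ℝ, ℝ) 𝓘(ℝ, ℝ) ∞ (fun t : ℝ ↦ τ * t) t :=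
    (contDiffAt_const.mul contDiffAt_id).contMDiffAt
  have hd : ∀ j, HasDerivAt (fun t ↦ a (τ * t) j)
      (τ * (-∑ k, a (τ * t) k * l j (c (τ * t)) (P.op Y (s k) (c (τ * t))))) t := fun j ↦ by
    have := (hasDerivAt_pi.1 h3 j).scomp t hm
    rwa [hBa] at this
  refine ⟨ContMDiffAt.comp t h1 hmm, m, fun j t ↦ a (τ * t) j, s,
    (ContMDiffMap.const τ : Fn EM M) • Y, fun j ↦ (hd j).differentiableAt, .of_forall fun _ ↦ rfl,
    ?_, ?_⟩
  · have h5 := mfderiv_comp t (h1.mdifferentiableAt (by simp)) (hmm.mdifferentiableAt (by simp))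
    change τ • Y.1 (c (τ * t)) = mfderiv 𝓘(ℝ, ℝ) 𝓘(ℝ, EM) (c ∘ fun t ↦ τ * t) t (1 : ℝ)
    rw [h5, h2, mfderiv_eq_fderiv]
    refine (map_smul (mfderiv 𝓘(ℝ, ℝ) 𝓘(ℝ, EM) c (τ * t)) τ (1 : ℝ)).symm.trans ?_
    change _ = mfderiv 𝓘(ℝ, ℝ) 𝓘(ℝ, EM) c (τ * t) (fderiv ℝ (fun t ↦ τ * t) t 1)
    rw [fderiv_apply_one_eq_deriv, hm.deriv]
    simp
    rfl
  · have h6 : ∀ k, P.op Y (s k) (c (τ * t)) =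
        ∑ j, l j (c (τ * t)) (P.op Y (s k) (c (τ * t))) • s j (c (τ * t)) := fun k ↦ by
      rw [hls, h4, one_smul]
    have h7 : ∀ k, P.op ((ContMDiffMap.const τ : Fn EM M) • Y) (s k) (c (τ * t)) =
        τ • P.op Y (s k) (c (τ * t)) := fun k ↦ by
      rw [P.smul_left]; rfl
    simp only [(hd _).deriv, h7, Finset.sum_add_distrib]
    have h8 : ∑ k, a (τ * t) k • τ • P.op Y (s k) (c (τ * t)) =
        ∑ j, (τ * ∑ k, a (τ * t) k * l j (c (τ * t)) (P.op Y (s k) (c (τ * t)))) •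
          s j (c (τ * t)) := by
      simp only [Finset.mul_sum, Finset.sum_smul]
      rw [Finset.sum_comm]
      refine Finset.sum_congr rfl fun k _ ↦ ?_
      conv_lhs => rw [h6 k]
      simp only [Finset.smul_sum, smul_smul]
      refine Finset.sum_congr rfl fun j _ ↦ ?_
      congr 1
      ring
    rw [h8, ← Finset.sum_add_distrib]
    refine Finset.sum_eq_zero fun j _ ↦ ?_
    rw [← add_smul, mul_neg, neg_add_cancel, zero_smul]

/-- Functions on `V/K` that are linear in the fibres and invariant under parallel transport
intertwine the partial connection with the Lie derivative. -/
theorem PartialConnection.lieD_eq_of_transport (ν : ∀ y, (V y ⧸ K.fiber y) →ₗ[ℝ] ℝ)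
    (N : K.QSec → Fn EM M) (hN : ∀ q y, N q y = ν y (q y))
    (hν : ∀ p q, P.Transport p q → ν p.1 p.2 = ν q.1 q.2) (Y : D.SSec) (q : K.QSec) :
    lieD Y.1 (N q) = N (P.op Y q) := by
  ext x
  obtain ⟨χ, m, s, l, hχ, hl, hls, -⟩ := K.exists_quot_frame x
  let f : Fin m → Fn EM M := fun j ↦ ⟨_, hl j q⟩
  obtain ⟨c, a, rfl, ha0, hc, hY, ha, hT⟩ := P.exists_transport Y x hχ hl hls fun j ↦ f j x
  have hχx := hχ.self_of_nhds
  have hχd := lieD_eq_zero_of_eventually_eq hχ Y.1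
  -- The function `ν` is evaluated on the parallel section through `q x`. It is constant there, so
  -- `h3` below is the claim for the combination of the frame whose coefficients are frozen at `x`.
  have h1 : HasDerivAt (fun τ ↦ ∑ j, a τ j * N (s j) (c τ))
      (∑ j, (-(∑ k, f k (c 0) * l j (c 0) (P.op Y (s k) (c 0))) * N (s j) (c 0) +
        a 0 j * lieD Y.1 (N (s j)) (c 0))) 0 :=
    HasDerivAt.fun_sum fun j _ ↦ (ha j).mul (hasDerivAt_comp_curve hc hY (N (s j)))
  have h2 : (fun τ ↦ ∑ j, a τ j * N (s j) (c τ)) =ᶠ[𝓝 0]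
      fun _ ↦ ∑ j, a 0 j * N (s j) (c 0) := by
    filter_upwards [hT] with τ hτ
    have := hν _ _ hτ
    simp only [map_sum, map_smul, smul_eq_mul] at this
    simp only [hN]
    exact this.symm
  have h3 := h1.unique ((hasDerivAt_const 0 _).congr_of_eventuallyEq h2)
  have h4 : χ • q = ∑ j, f j • s j := by
    apply Subbundle.QSec.ext
    intro y
    rw [qsec_sum_apply]
    exact (hls y (q y)).symm
  have h5 : ∀ k, ν (c 0) (P.op Y (s k) (c 0)) =
      ∑ j, l j (c 0) (P.op Y (s k) (c 0)) * N (s j) (c 0) := fun k ↦ by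
    have := congrArg (ν (c 0)) (hls (c 0) (P.op Y (s k) (c 0)))
    rw [hχx, one_smul] at this
    rw [← this]
    simp only [map_sum, map_smul, smul_eq_mul, hN]
  have h6 := congrArg (fun r : K.QSec ↦ ν (c 0) (r (c 0))) (congrArg (P.op Y) h4)
  simp only [P.leibniz, P.op_sum, qsec_sum_apply, Subbundle.quot_add_apply,
    Subbundle.quot_smul_apply, hχx, hχd, one_smul, zero_smul, add_zero, map_sum, map_add, map_smul,
    smul_eq_mul] at h6
  have h7 : χ * N q = ∑ j, f j * N (s j) := by
    ext y
    have := congrArg (fun r : K.QSec ↦ ν y (r y)) h4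
    simp only [qsec_sum_apply, Subbundle.quot_smul_apply, map_sum, map_smul, smul_eq_mul] at this
    rw [fn_sum_apply]
    simpa only [ContMDiffMap.coe_mul, Pi.mul_apply, hN] using this
  have h8 : lieD Y.1 (N q) (c 0) =
      ∑ j, (f j (c 0) * lieD Y.1 (N (s j)) (c 0) + lieD Y.1 (f j) (c 0) * N (s j) (c 0)) := by
    have e1 : lieD Y.1 (∑ j, f j * N (s j)) = ∑ j, lieD Y.1 (f j * N (s j)) :=
      map_sum (AddMonoidHom.mk' (lieD Y.1) (lieD_add_right Y.1)) _ _
    have := DFunLike.congr_fun ((congrArg (lieD Y.1) h7).trans e1) (c 0)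
    rw [fn_sum_apply] at this
    simp only [lieD_mul, ContMDiffMap.coe_mul, ContMDiffMap.coe_add, Pi.mul_apply, Pi.add_apply,
      hχx, hχd, one_mul, zero_mul, add_zero] at this
    exact this
  -- Both sides contain the same terms with `Y(f j)`, by the Leibniz rule; what remains is `h3`.
  rw [h8, hN, h6]
  rw [ha0] at h3
  simp only [h5, Finset.sum_add_distrib, ← hN] at h3 ⊢
  congr 1
  simp only [neg_mul, Finset.sum_neg_distrib, Finset.sum_mul, mul_assoc] at h3
  rw [Finset.sum_comm] at h3
  simp only [Finset.mul_sum]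
  linarith

end Existence

/-! ### The Atiyah class of an induced fibration -/

section Vanishing

variable {EM : Type*} [NormedAddCommGroup EM] [NormedSpace ℝ EM] [FiniteDimensional ℝ EM]
  {M : Type*} [TopologicalSpace M] [ChartedSpace EM M] [IsManifold 𝓘(ℝ, EM) ∞ M] [T2Space M]
  [SigmaCompactSpace M]
  {F : Type*} [NormedAddCommGroup F] [NormedSpace ℝ F]
  {V : M → Type*} [∀ x, AddCommGroup (V x)] [∀ x, Module ℝ (V x)]
  [∀ x, TopologicalSpace (V x)] [TopologicalSpace (TotalSpace F V)] [FiberBundle F V]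
  [VectorBundle ℝ F V]
  {D : InvolutiveSubbundle EM M} {K : Subbundle EM F V} {P : PartialConnection D K}

/-! ### Lifting a connection along a split surjection. -/

section LiftConnection

variable {F₁ : Type*} [NormedAddCommGroup F₁] [NormedSpace ℝ F₁]
  {W : M → Type*} [∀ x, AddCommGroup (W x)] [∀ x, Module ℝ (W x)]
  [∀ x, TopologicalSpace (W x)] [TopologicalSpace (TotalSpace F₁ W)] [FiberBundle F₁ W]
  [VectorBundle ℝ F₁ W]

/-- The lift of a linear connection along a split surjection, equal to a given connection on the
kernel. -/
def liftConnection (N : LinearConnection EM F V) (B : LinearConnection EM F₁ W)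
    (L : Sec EM F V →ₗ[Fn EM M] Sec EM F₁ W) (Λ : Sec EM F₁ W →ₗ[Fn EM M] Sec EM F V)
    (h : ∀ w, L (Λ w) = w) : LinearConnection EM F V where
  -- The section splits into `e - Λ (L e)` in the kernel of `L` and `Λ (L e)`. On the first part `N`
  -- is followed by the projection `1 - Λ L` onto the kernel; on the second part `B` acts.
  op X e := N.op X (e - Λ (L e)) - Λ (L (N.op X (e - Λ (L e)))) + Λ (B.op X (L e))
  add_left X Y e := by simp only [N.add_left, B.add_left, map_add]; abel
  smul_left f X e := by simp only [N.smul_left, B.smul_left, map_smul]; module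
  add_right X e e' := by
    have : e + e' - Λ (L (e + e')) = (e - Λ (L e)) + (e' - Λ (L e')) := by
      simp only [map_add]; abel
    rw [this]
    simp only [N.add_right, B.add_right, map_add]; abel
  leibniz X f e := by
    have : f • e - Λ (L (f • e)) = f • (e - Λ (L e)) := by
      simp only [map_smul, smul_sub]
    rw [this]
    simp only [N.leibniz, B.leibniz, map_add, map_smul, map_sub, h]; module

theorem map_liftConnection_op (N : LinearConnection EM F V) (B : LinearConnection EM F₁ W)
    (L : Sec EM F V →ₗ[Fn EM M] Sec EM F₁ W) (Λ : Sec EM F₁ W →ₗ[Fn EM M] Sec EM F V)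
    (h : ∀ w, L (Λ w) = w) (X : VF EM M) (e : Sec EM F V) :
    L ((liftConnection N B L Λ h).op X e) = B.op X (L e) := by
  change L (_ - Λ (L _) + Λ _) = _
  rw [map_add, map_sub, h, h, sub_self, zero_add]

theorem map_liftConnection_curv (N : LinearConnection EM F V) (B : LinearConnection EM F₁ W)
    (L : Sec EM F V →ₗ[Fn EM M] Sec EM F₁ W) (Λ : Sec EM F₁ W →ₗ[Fn EM M] Sec EM F V)
    (h : ∀ w, L (Λ w) = w) (X Y : VF EM M) (e : Sec EM F V) :
    L ((liftConnection N B L Λ h).curv X Y e) = B.curv X Y (L e) := by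
  simp only [LinearConnection.curv, map_sub, map_liftConnection_op]

end LiftConnection

/-! ### Comparison of two extensions. -/

theorem IsExtension.sub_mem {N N₀ : LinearConnection EM F V} (hN : IsExtension P N)
    (hN₀ : IsExtension P N₀) (Y : D.SSec) (e : Sec EM F V) :
    N.op Y.1 e - N₀.op Y.1 e ∈ K.sections := by
  rw [← K.proj_eq_zero, map_sub, hN.extends_op, hN₀.extends_op, sub_self]

/-- The map `ē ↦ (∇_X e - ∇⁰_X e) ‾` of two extensions. -/
def IsExtension.diffAux {N N₀ : LinearConnection EM F V} (hN : IsExtension P N)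
    (hN₀ : IsExtension P N₀) (X : VF EM M) : K.QSec →ₗ[Fn EM M] K.QSec :=
  K.desc
    { toFun := fun e ↦ K.proj (N.op X e - N₀.op X e)
      map_add' := fun e e' ↦ by
        rw [← map_add, N.add_right, N₀.add_right]
        congr 1; abel
      map_smul' := fun f e ↦ by
        rw [N.leibniz, N₀.leibniz, RingHom.id_apply, ← map_smul]
        congr 1; module }
    (fun e he ↦ K.proj_eq_zero.2
      (K.sections.sub_mem (hN.restricts X e he) (hN₀.restricts X e he)))

theorem IsExtension.diffAux_proj {N N₀ : LinearConnection EM F V} (hN : IsExtension P N)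
    (hN₀ : IsExtension P N₀) (X : VF EM M) (e : Sec EM F V) :
    hN.diffAux hN₀ X (K.proj e) = K.proj (N.op X e - N₀.op X e) := by
  rw [diffAux, Subbundle.desc_proj]; rfl

/-- The difference of two extensions, as a section of `Hom(TM/D, End(V/K))`. -/
def IsExtension.diff {N N₀ : LinearConnection EM F V} (hN : IsExtension P N)
    (hN₀ : IsExtension P N₀) : Omega0 D K :=
  D.desc
    { toFun := fun X ↦ hN.diffAux hN₀ X
      map_add' := fun X X' ↦ by
        ext1 s
        obtain ⟨e, rfl⟩ := K.proj_surjective s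
        simp only [LinearMap.add_apply, diffAux_proj]
        rw [← map_add, N.add_left, N₀.add_left]
        congr 1; abel
      map_smul' := fun f X ↦ by
        ext1 s
        obtain ⟨e, rfl⟩ := K.proj_surjective s
        simp only [LinearMap.smul_apply, diffAux_proj, RingHom.id_apply]
        rw [N.smul_left, N₀.smul_left, ← map_smul, smul_sub] }
    (fun X hX ↦ by
      ext1 s
      obtain ⟨e, rfl⟩ := K.proj_surjective s
      exact (hN.diffAux_proj hN₀ X e).trans (K.proj_eq_zero.2 (hN.sub_mem hN₀ ⟨X, hX⟩ e)))

theorem IsExtension.diff_proj {N N₀ : LinearConnection EM F V} (hN : IsExtension P N)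
    (hN₀ : IsExtension P N₀) (X : VF EM M) (e : Sec EM F V) :
    hN.diff hN₀ (D.proj X) (K.proj e) = K.proj (N.op X e - N₀.op X e) := by
  rw [diff, Subbundle.desc_proj]; exact hN.diffAux_proj hN₀ X e

/-- Modulo `K`, both `∇_Y` and `∇⁰_Y` are `P_Y`. The only mixed term is then `∇⁰_X ∇_Y e`, which may
be replaced by `∇⁰_X ∇⁰_Y e`, because `∇_Y e - ∇⁰_Y e` lies in `K` and `∇⁰` preserves `K`. -/
theorem IsExtension.d0_diff {N N₀ : LinearConnection EM F V} (hP : P.IsFlat)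
    (hN : IsExtension P N) (hN₀ : IsExtension P N₀) :
    P.d0 (hN.diff hN₀) = hN.form hP - hN₀.form hP := by
  ext Y s t : 3
  obtain ⟨X, rfl⟩ := D.proj_surjective s
  obtain ⟨e, rfl⟩ := K.proj_surjective t
  have h : K.proj (N₀.op X (N.op Y.1 e)) = K.proj (N₀.op X (N₀.op Y.1 e)) := by
    rw [← sub_eq_zero, ← map_sub, ← N₀.op_sub]
    exact K.proj_eq_zero.2 (hN₀.restricts _ _ (hN.sub_mem hN₀ Y e))
  simp only [PartialConnection.d0_apply, LinearMap.sub_apply, PartialConnection.homOp_apply,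
    InvolutiveSubbundle.bott_op_proj, form_proj, diff_proj]
  rw [← hN.extends_op Y e, diff_proj]
  simp only [map_sub, P.op_sub, LinearConnection.curv, h]
  rw [← hN.extends_op, ← hN₀.extends_op]
  abel

/-- The form of `N₀` is zero, so the difference of the connections is a primitive of the form of
`N`. -/
theorem atiyahClass_eq (hP : P.IsFlat) {N N₀ : LinearConnection EM F V}
    (hN : IsExtension P N) (hN₀ : IsExtension P N₀)
    (h : ∀ (Y : D.SSec) X e, K.proj (N₀.curv Y.1 X e) = 0) : atiyahClass P hP N hN = 0 := by
  refine (PartialConnection.H1.mk_eq_zero P _).2 ⟨hN.diff hN₀, ?_⟩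
  have h0 : hN₀.form hP = 0 := by
    ext Y s t : 3
    obtain ⟨X, rfl⟩ := D.proj_surjective s
    obtain ⟨e, rfl⟩ := K.proj_surjective t
    exact (hN₀.form_proj hP Y X e).trans (h Y X e)
  rw [hN.d0_diff hP hN₀, h0]
  exact sub_zero (hN.form hP)

/-! ### The extension obtained from the quotient bundle. -/

variable [FiniteDimensional ℝ F] [ContMDiffVectorBundle ∞ F V 𝓘(ℝ, EM)]
  {EM' : Type*} [NormedAddCommGroup EM'] [NormedSpace ℝ EM'] [FiniteDimensional ℝ EM']
  {M' : Type*} [TopologicalSpace M'] [ChartedSpace EM' M'] [IsManifold 𝓘(ℝ, EM') ∞ M'] [T2Space M']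
  {F' : Type*} [NormedAddCommGroup F'] [NormedSpace ℝ F']
  {V' : M' → Type*} [∀ x, AddCommGroup (V' x)] [∀ x, Module ℝ (V' x)]
  [∀ x, TopologicalSpace (V' x)] [TopologicalSpace (TotalSpace F' V')] [FiberBundle F' V']
  [VectorBundle ℝ F' V'] [ContMDiffVectorBundle ∞ F' V' 𝓘(ℝ, EM')]

/-- The base map of a fibration, as a smooth map. -/
def Fibration.baseMap (Φ : Fibration EM F V EM' F' V') :
    C^∞⟮𝓘(ℝ, EM), M; 𝓘(ℝ, EM'), M'⟯ :=
  ⟨Φ.base, Φ.base_submersion.contMDiff⟩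

/-- The map on sections, with values in the pullback bundle. -/
def Fibration.secMap (Φ : Fibration EM F V EM' F' V') :
    Sec EM F V →ₗ[Fn EM M] Sec EM F' (Φ.baseMap *ᵖ V') where
  toFun e := secAlong Φ.baseMap (fun x ↦ Φ.map x (e x)) (Φ.smooth.comp e.contMDiff)
  map_add' e e' := by
    ext x
    exact map_add (Φ.map x) (e x) (e' x)
  map_smul' f e := by
    ext x
    exact map_smul (Φ.map x) (f x) (e x)

theorem Fibration.secMap_apply (Φ : Fibration EM F V EM' F' V') (e : Sec EM F V) (x : M) :
    Φ.secMap e x = Φ.map x (e x) := rfl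

/-- If `v` is mapped to zero, it is identified with the zero vector, so its class is equivalent to
`0` under transport. Transport preserves vanishing, so the class is `0`. -/
theorem IsInducedFibration.map_eq_zero_iff {Φ : Fibration EM F V EM' F' V'}
    (hΦ : IsInducedFibration P Φ) {x : M} {v : V x} : Φ.map x v = 0 ↔ v ∈ K.fiber x := by
  constructor
  · intro h
    have h1 := (hΦ.identifies x x v 0).1 (by rw [h, map_zero])
    have h2 := (h1.eq_zero_iff (P := P)).2 (map_zero _)
    exact (Submodule.Quotient.mk_eq_zero _).1 h2
  · intro h
    have h1 : (K.fiber x).mkQ v = (K.fiber x).mkQ 0 := by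
      rw [map_zero]
      exact (Submodule.Quotient.mk_eq_zero _).2 h
    have h2 := (hΦ.identifies x x v 0).2 (by rw [h1]; exact Relation.EqvGen.refl _)
    rw [TotalSpace.mk_inj, map_zero] at h2
    exact h2

/-- This plays the role of the isomorphism of `V/K` with the pullback bundle: identities in `Γ(V/K)`
may be checked after `Φ.secMap`. -/
theorem IsInducedFibration.secMap_eq_zero_iff {Φ : Fibration EM F V EM' F' V'}
    (hΦ : IsInducedFibration P Φ) {e : Sec EM F V} : Φ.secMap e = 0 ↔ K.proj e = 0 := by
  rw [K.proj_eq_zero, K.mem_sections]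
  refine ⟨fun h x ↦ hΦ.map_eq_zero_iff.1 (DFunLike.congr_fun h x), fun h ↦ ?_⟩
  ext x
  exact hΦ.map_eq_zero_iff.2 (h x)

/-- Along `D`, the pullback connection is induced by the partial connection. -/
theorem IsInducedFibration.pullback_op_secMap {Φ : Fibration EM F V EM' F' V'}
    (hΦ : IsInducedFibration P Φ) {ι : Type*} (A : FrameAtlas EM' F' V' ι) (Y : D.SSec)
    {e e' : Sec EM F V} (he : K.proj e' = P.op Y (K.proj e)) :
    (A.pullback Φ.baseMap).connection.op Y.1 (Φ.secMap e) = Φ.secMap e' := by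
  have key : ∀ i a, lieD Y.1 ((A.pullback Φ.baseMap).coeff i a (Φ.secMap e)) =
      (A.pullback Φ.baseMap).coeff i a (Φ.secMap e') := by
    intro i a
    -- `κ` is a cut-off coordinate on `V'` and `ν` is its pullback to `V/K`. Transported vectors
    -- have the same image in `V'`, so `ν` is invariant under transport.
    let κ : ∀ y, V' y →ₗ[ℝ] ℝ := fun y ↦ A.χ i y • (A.frame i).coeff a y
    let ν : ∀ y, (V y ⧸ K.fiber y) →ₗ[ℝ] ℝ := fun y ↦
      (K.fiber y).liftQ (κ (Φ.base y) ∘ₗ Φ.map y) fun v hv ↦ by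
        rw [LinearMap.mem_ker, LinearMap.comp_apply, hΦ.map_eq_zero_iff.2 hv, map_zero]
    let N : K.QSec → Fn EM M := fun q ↦
      (A.pullback Φ.baseMap).coeff i a (Φ.secMap (K.lift q))
    have hc : ∀ (e : Sec EM F V) y, (A.pullback Φ.baseMap).coeff i a (Φ.secMap e) y =
      ν y ((K.fiber y).mkQ (e y)) := fun e y ↦ rfl
    have hN : ∀ q y, N q y = ν y (q y) := fun q y ↦ by
      conv_rhs => rw [← K.proj_lift q]
      exact hc _ y
    have hNp : ∀ e, N (K.proj e) = (A.pullback Φ.baseMap).coeff i a (Φ.secMap e) := fun e ↦ by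
      ext y
      rw [hN, hc]
      rfl
    rw [← hNp, ← hNp, he]
    refine P.lieD_eq_of_transport ν N hN ?_ Y _
    rintro ⟨x, p⟩ ⟨y, q⟩ h
    obtain ⟨v, rfl⟩ := (K.fiber x).mkQ_surjective p
    obtain ⟨w, rfl⟩ := (K.fiber y).mkQ_surjective q
    exact congrArg (fun z : TotalSpace F' V' ↦ κ z.1 z.2)
      ((hΦ.identifies x y v w).2 (Relation.EqvGen.rel _ _ h))
  rw [FrameAtlas.connection_op]
  simp only [key, FrameAtlas.sum_coeff, FrameAtlas.glue_smul]

variable [SigmaCompactSpace M'] [FiniteDimensional ℝ F']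

/-- The lift of the pullback connection works: `Φ.secMap` intertwines the two connections and their
curvatures, so all three properties are checked on the pullback bundle. -/
theorem IsInducedFibration.exists_extension {Φ : Fibration EM F V EM' F' V'}
    (hΦ : IsInducedFibration P Φ) : ∃ N : LinearConnection EM F V, IsExtension P N ∧
      ∀ (Y : D.SSec) X e, K.proj (N.curv Y.1 X e) = 0 := by
  obtain ⟨A⟩ := exists_frameAtlas (EM := EM') (F := F') (V := V')
  obtain ⟨A₀⟩ := exists_frameAtlas (EM := EM) (F := F) (V := V)
  obtain ⟨Λ, hΛ⟩ := exists_rightInverse (W := Φ.baseMap *ᵖ V') (fun x ↦ Φ.map x)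
    Φ.secMap Φ.secMap_apply Φ.map_surjective
  refine ⟨liftConnection A₀.connection (A.pullback Φ.baseMap).connection Φ.secMap Λ hΛ, ⟨?_, ?_⟩, ?_⟩
  · intro X e he
    rw [← K.proj_eq_zero, ← hΦ.secMap_eq_zero_iff] at he ⊢
    rw [map_liftConnection_op, he, LinearConnection.op_zero]
  · intro Y e
    obtain ⟨e', he'⟩ := K.proj_surjective (P.op Y (K.proj e))
    rw [← he', ← sub_eq_zero, ← map_sub, ← hΦ.secMap_eq_zero_iff, map_sub, map_liftConnection_op,
      hΦ.pullback_op_secMap A Y he', sub_self]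
  · intro Y X e
    rw [← hΦ.secMap_eq_zero_iff, map_liftConnection_curv]
    exact A.pullback_curv_eq_zero Φ.baseMap (fun x ↦ (hΦ.leaves x _).2 (Y.2 x)) X _

end Vanishing

end VBAtiyah

end

theorem mainTheorem6
    -- the smooth manifold `M`
    {EM : Type*} [NormedAddCommGroup EM] [NormedSpace ℝ EM] [FiniteDimensional ℝ EM]
    {M : Type*} [TopologicalSpace M] [ChartedSpace EM M] [IsManifold 𝓘(ℝ, EM) ∞ M]
    [T2Space M] [SigmaCompactSpace M]
    -- the smooth vector bundle `E → M`
    {F : Type*} [NormedAddCommGroup F] [NormedSpace ℝ F] [FiniteDimensional ℝ F]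
    {E : M → Type*} [∀ x, AddCommGroup (E x)] [∀ x, Module ℝ (E x)]
    [∀ x, TopologicalSpace (E x)] [TopologicalSpace (Bundle.TotalSpace F E)] [FiberBundle F E]
    [VectorBundle ℝ F E] [ContMDiffVectorBundle ∞ F E 𝓘(ℝ, EM)]
    -- the subbundles `K ⊆ E` and `D = F_M ⊆ TM` and the flat `D`-connection on `E/K`
    (K : VBAtiyah.Subbundle EM F E) (D : VBAtiyah.InvolutiveSubbundle EM M)
    (P : VBAtiyah.PartialConnection D K) (hP : P.IsFlat)
    -- the smooth manifold `M' = M/D` and the smooth vector bundle `E' = (E/K)/∇ → M'`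
    {EM' : Type*} [NormedAddCommGroup EM'] [NormedSpace ℝ EM'] [FiniteDimensional ℝ EM']
    {M' : Type*} [TopologicalSpace M'] [ChartedSpace EM' M'] [IsManifold 𝓘(ℝ, EM') ∞ M']
    [T2Space M'] [SigmaCompactSpace M']
    {F' : Type*} [NormedAddCommGroup F'] [NormedSpace ℝ F'] [FiniteDimensional ℝ F']
    {E' : M' → Type*} [∀ x, AddCommGroup (E' x)] [∀ x, Module ℝ (E' x)]
    [∀ x, TopologicalSpace (E' x)] [TopologicalSpace (Bundle.TotalSpace F' E')]
    [FiberBundle F' E'] [VectorBundle ℝ F' E'] [ContMDiffVectorBundle ∞ F' E' 𝓘(ℝ, EM')]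
    (Φ : VBAtiyah.Fibration EM F E EM' F' E') (hΦ : VBAtiyah.IsInducedFibration P Φ) :
    -- the Atiyah class is defined, and it vanishes for every choice of an extension
    (∃ N : VBAtiyah.LinearConnection EM F E, VBAtiyah.IsExtension P N) ∧
      ∀ (N : VBAtiyah.LinearConnection EM F E) (hN : VBAtiyah.IsExtension P N),
        VBAtiyah.atiyahClass P hP N hN = 0 := by
  obtain ⟨N₀, hN₀, h⟩ := hΦ.exists_extension
  exact ⟨⟨N₀, hN₀⟩, fun N hN ↦ VBAtiyah.atiyahClass_eq hP hN hN₀ h⟩
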